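/- Let $\alpha$ be an injective $*$-endomorphism of a (not necessarily unital) $C^*$-algebra $\mathfrak A$. Let $(\mathfrak B,\beta,j)$ be its minimal automorphic extension: $\mathfrak B$ is a $C^*$-algebra, $\beta$ is a $*$-automorphism of $\mathfrak B$, and $j:\mathfrak A\to\mathfrak B$ is an injective $*$-homomorphism such that $\beta j=j\alpha$ and $\mathfrak B=\overline{\bigcup_{k\ge 0}\beta^{-k}(j(\mathfrak A))}$. A contractive covariant representation of $(\mathfrak A,\alpha)$ is a pair $(\pi,K)$ where $\pi$ is a completely contractive homomorphism of $\mathfrak A$ into $B(H)$, $H$ a Hilbert space, and $K\in B(H)$ is a contraction with $\pi(a)K=K\pi(\alpha(a))$ for all $a\in\mathfrak A$. The semicrossed product $\mathfrak A\times_\alpha\mathbb Z^+$ is the operator algebra obtained by completing the algebra of polynomials $\sum_{n=0}^N V^na_n$ ($a_n\in\mathfrak A$, with $aV=V\alpha(a)$), after dividing out the elements of norm zero, where the norm of a matrix of polynomials is the supremum of the norms of its images under all contractive covariant representations ($V^na\mapsto K^n\pi(a)$). The crossed product $\mathfrak B\times_\beta\mathbb Z$ is the universal $C^*$-algebra generated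 by the Laurent polynomials $\sum_{|n|\le N} U^nb_n$ ($b_n\in\mathfrak B$), where $U$ is unitary and $bU=U\beta(b)$ for all $b\in\mathfrak B$. Then there is a completely isometric algebra homomorphism $$\Phi:\mathfrak A\times_\alpha\mathbb Z^+\to\mathfrak B\times_\beta\mathbb Z,\qquad \Phi(V^na)=U^nj(a)\quad(n\ge 0,\ a\in\mathfrak A),$$ and $\mathfrak B\times_\beta\mathbb Z$ is a $C^*$-cover of $\Phi(\mathfrak A\times_\alpha\mathbb Z^+)$, that is, it is generated by $\Phi(\mathfrak A\times_\alpha\mathbb Z^+)$ as a $C^*$-algebra. -/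

import Mathlib

open scoped ENNReal

universe u v

noncomputable section

namespace Semicrossed

/-- The C⋆-algebra of bounded operators on a complex Hilbert space. -/
abbrev BH (H : Type*) [NormedAddCommGroup H] [InnerProductSpace ℂ H] : Type _ := H →L[ℂ] H

/-! ### Matrix norms, complete contractions, complete isometries

An operator algebra is a (not necessarily selfadjoint) subalgebra `S` of a C⋆-algebra `E`; the norm
of a matrix over `S` is its norm in the C⋆-algebra `M_n(E)`. -/

/-- The C⋆-norm on `M_n(E)` for a C⋆-algebra `E`, equipped with its canonical order
(in which the positive elements are the `star x * x`). -/
def matrixNorm {E : Type*} [NonUnitalCStarAlgebra E] {n : ℕ} (M : Matrix (Fin n) (Fin n) E) : ℝ :=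
  letI := CStarAlgebra.spectralOrder E
  haveI := CStarAlgebra.spectralOrderedRing E
  ‖CStarMatrix.ofMatrix M‖

/-- Complete contractivity: every amplification `M_n(A) → M_n(B)` is contractive. -/
def IsCompletelyContractive {A B : Type*} [NonUnitalCStarAlgebra A] [NonUnitalCStarAlgebra B]
    (φ : A → B) : Prop :=
  ∀ (n : ℕ) (M : Matrix (Fin n) (Fin n) A), matrixNorm (M.map φ) ≤ matrixNorm M

/-- Complete isometry of a map from an operator algebra `S ⊆ E` into a C⋆-algebra `F`:
every amplification `M_n(S) → M_n(F)` is isometric. -/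
def IsCompletelyIsometric {E F : Type*} [NonUnitalCStarAlgebra E] [NonUnitalCStarAlgebra F]
    {S : NonUnitalSubalgebra ℂ E} (φ : S → F) : Prop :=
  ∀ (n : ℕ) (M : Matrix (Fin n) (Fin n) S),
    matrixNorm (M.map φ) = matrixNorm (M.map (fun s : S => (s : E)))

/-- `C` is a C⋆-cover of its subalgebra `S`: `S` generates `C` as a C⋆-algebra. -/
def IsCStarCover {C : Type*} [NonUnitalCStarAlgebra C] (S : NonUnitalSubalgebra ℂ C) : Prop :=
  (NonUnitalStarAlgebra.adjoin ℂ (S : Set C)).topologicalClosure = ⊤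

theorem norm_entry_le_matrixNorm {E : Type*} [NonUnitalCStarAlgebra E] {n : ℕ}
    (M : Matrix (Fin n) (Fin n) E) (i j : Fin n) : ‖M i j‖ ≤ matrixNorm M := by
  let _ := CStarAlgebra.spectralOrder E
  have := CStarAlgebra.spectralOrderedRing E
  exact CStarMatrix.norm_entry_le_norm (M := CStarMatrix.ofMatrix M)

theorem matrixNorm_one_by_one {E : Type*} [NonUnitalCStarAlgebra E] (a : E) :
    matrixNorm (fun _ _ : Fin 1 => a) = ‖a‖ := by
  let _ := CStarAlgebra.spectralOrder E
  have := CStarAlgebra.spectralOrderedRing E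
  let f : E →⋆ₙₐ[ℂ] CStarMatrix (Fin 1) (Fin 1) E :=
    { toFun := fun x => CStarMatrix.ofMatrix fun _ _ => x
      map_smul' := fun _ _ => rfl
      map_zero' := rfl
      map_add' := fun _ _ => rfl
      map_mul' := fun x y => by
        ext i j
        simp [CStarMatrix.mul_apply]
        rfl
      map_star' := fun _ => rfl }
  exact NonUnitalStarAlgHom.norm_map f
    (fun x y h => congrArg (fun M : CStarMatrix (Fin 1) (Fin 1) E => M 0 0) h) a

theorem IsCompletelyContractive.norm_le {A B : Type*} [NonUnitalCStarAlgebra A]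
    [NonUnitalCStarAlgebra B] {φ : A → B} (h : IsCompletelyContractive φ) (a : A) :
    ‖φ a‖ ≤ ‖a‖ :=
  (norm_entry_le_matrixNorm (Matrix.map (fun _ _ : Fin 1 => a) φ) 0 0).trans
    ((h 1 fun _ _ => a).trans_eq (matrixNorm_one_by_one a))

/-! ### The contractive semicrossed product `A ×_α ℤ⁺` -/

/-- A contractive covariant representation `(π, K)` of `(A, α)` on a Hilbert space `H`:
`π` is a completely contractive homomorphism into `B(H)`, `K` is a contraction, and
`π(a) K = K π(α(a))`. -/
structure ContractiveCovRep {A : Type u} [NonUnitalCStarAlgebra A] (α : A →⋆ₙₐ[ℂ] A) where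
  H : Type u
  [instNACG : NormedAddCommGroup H]
  [instIPS : InnerProductSpace ℂ H]
  [instComplete : CompleteSpace H]
  π : A →ₙₐ[ℂ] BH H
  cc : IsCompletelyContractive π
  K : BH H
  norm_K_le : ‖K‖ ≤ 1
  covariance : ∀ a : A, π a * K = K * π (α a)

attribute [instance] ContractiveCovRep.instNACG ContractiveCovRep.instIPS
  ContractiveCovRep.instComplete

section Semicrossed

variable {A : Type u} [NonUnitalCStarAlgebra A] (α : A →⋆ₙₐ[ℂ] A)

/-- The C⋆-algebra of bounded families `(T_ρ)`, `T_ρ ∈ B(H_ρ)`, where `ρ` runs over all contractive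
covariant representations of `(A, α)`. -/
abbrev SemicrossedAmbient : Type (u + 1) :=
  lp (fun ρ : ContractiveCovRep.{u} α => BH ρ.H) ∞

theorem ContractiveCovRep.norm_pow_mul_le {α : A →⋆ₙₐ[ℂ] A} (ρ : ContractiveCovRep α) (n : ℕ)
    (a : A) : ‖ρ.K ^ n * ρ.π a‖ ≤ ‖a‖ := by
  induction n with
  | zero => simpa using ρ.cc.norm_le a
  | succ n ih =>
    rw [pow_succ', mul_assoc]
    calc ‖ρ.K * (ρ.K ^ n * ρ.π a)‖ ≤ ‖ρ.K‖ * ‖ρ.K ^ n * ρ.π a‖ := norm_mul_le _ _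
      _ ≤ 1 * ‖a‖ := mul_le_mul ρ.norm_K_le ih (norm_nonneg _) zero_le_one
      _ = ‖a‖ := one_mul _

/-- The monomial `Vⁿ a`, where `V = (K_ρ)_ρ` is the universal contraction and `a` is identified with
`(π_ρ(a))_ρ`. -/
def semicrossedMonomial (n : ℕ) (a : A) : SemicrossedAmbient α :=
  ⟨fun ρ => ρ.K ^ n * ρ.π a, memℓp_infty ⟨‖a‖, by
    rintro _ ⟨ρ, rfl⟩
    exact ρ.norm_pow_mul_le n a⟩⟩

/-- The contractive semicrossed product `A ×_α ℤ⁺`: the universal operator algebra generated by the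
polynomials `∑ₙ Vⁿ aₙ` subject to `a V = V α(a)` and `‖V‖ ≤ 1`, realised as the closed algebra that
they generate in the universal contractive covariant representation (the direct product of all of
them).  When `A` and `α` are unital, it contains `V = V 1`. -/
def SemicrossedProduct : NonUnitalSubalgebra ℂ (SemicrossedAmbient α) :=
  (NonUnitalAlgebra.adjoin ℂ
    {x | ∃ (n : ℕ) (a : A), x = semicrossedMonomial α n a}).topologicalClosure

/-- The monomial `Vⁿ a` as an element of `A ×_α ℤ⁺`. -/
def SemicrossedProduct.monomial (n : ℕ) (a : A) : SemicrossedProduct α :=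
  ⟨semicrossedMonomial α n a, NonUnitalSubalgebra.le_topologicalClosure _
    (NonUnitalAlgebra.subset_adjoin ℂ ⟨n, a, rfl⟩)⟩

end Semicrossed

/-! ### The crossed product `B ×_β ℤ` by an automorphism -/

/-- A covariant representation `(σ, U)` of `(B, β)` on a Hilbert space `H`: `σ` is a
⋆-representation of `B`, `U` is a unitary, and `σ(b) U = U σ(β(b))`. -/
structure UnitaryCovRep {B : Type u} [NonUnitalCStarAlgebra B] (β : B ≃⋆ₐ[ℂ] B) where
  H : Type u
  [instNACG : NormedAddCommGroup H]
  [instIPS : InnerProductSpace ℂ H]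
  [instComplete : CompleteSpace H]
  σ : B →⋆ₙₐ[ℂ] BH H
  U : unitary (BH H)
  covariance : ∀ b : B, σ b * (U : BH H) = (U : BH H) * σ (β b)

attribute [instance] UnitaryCovRep.instNACG UnitaryCovRep.instIPS UnitaryCovRep.instComplete

section Crossed

variable {B : Type u} [NonUnitalCStarAlgebra B] (β : B ≃⋆ₐ[ℂ] B)

/-- The C⋆-algebra of bounded families `(T_ρ)`, `T_ρ ∈ B(H_ρ)`, where `ρ` runs over all covariant
representations of `(B, β)`. -/
abbrev CrossedAmbient : Type (u + 1) :=
  lp (fun ρ : UnitaryCovRep.{u} β => BH ρ.H) ∞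

/-- The monomial `Uⁿ b`, `n ∈ ℤ`, where `U = (U_ρ)_ρ` is the universal unitary and `b` is identified
with `(σ_ρ(b))_ρ`. -/
def crossedMonomial (n : ℤ) (b : B) : CrossedAmbient β :=
  ⟨fun ρ => ((ρ.U ^ n : unitary (BH ρ.H)) : BH ρ.H) * ρ.σ b, memℓp_infty ⟨‖b‖, by
    rintro _ ⟨ρ, rfl⟩
    show ‖((ρ.U ^ n : unitary (BH ρ.H)) : BH ρ.H) * ρ.σ b‖ ≤ ‖b‖
    rw [CStarRing.norm_coe_unitary_mul]
    exact NonUnitalStarAlgHom.norm_apply_le ρ.σ b⟩⟩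

/-- The (full) crossed product C⋆-algebra `B ×_β ℤ`: the universal C⋆-algebra generated by the
Laurent polynomials `∑ₙ Uⁿ bₙ` subject to `b U = U β(b)` with `U` unitary, realised as the
C⋆-algebra that they generate in the universal covariant representation. -/
def CrossedProduct : NonUnitalStarSubalgebra ℂ (CrossedAmbient β) :=
  (NonUnitalStarAlgebra.adjoin ℂ
    {x | ∃ (n : ℤ) (b : B), x = crossedMonomial β n b}).topologicalClosure

instance CrossedProduct.instNonUnitalCStarAlgebra : NonUnitalCStarAlgebra (CrossedProduct β) :=
  NonUnitalStarSubalgebra.nonUnitalCStarAlgebra _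
    (h_closed := NonUnitalStarSubalgebra.isClosed_topologicalClosure _)

/-- The monomial `Uⁿ b` as an element of `B ×_β ℤ`. -/
def CrossedProduct.monomial (n : ℤ) (b : B) : CrossedProduct β :=
  ⟨crossedMonomial β n b, NonUnitalStarSubalgebra.le_topologicalClosure _
    (NonUnitalStarAlgebra.subset_adjoin ℂ _ ⟨n, b, rfl⟩)⟩

end Crossed

/-! ### Minimal automorphic extensions -/

/-- `(B, β, j)` is the minimal automorphic extension of `(A, α)`: `j` is an injective
⋆-homomorphism, `β j = j α`, and `B` is the closure of `⋃ₖ β⁻ᵏ(j(A))`. -/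
structure IsMinimalAutomorphicExtension {A : Type u} {B : Type v} [NonUnitalCStarAlgebra A]
    [NonUnitalCStarAlgebra B] (α : A →⋆ₙₐ[ℂ] A) (β : B ≃⋆ₐ[ℂ] B) (j : A →⋆ₙₐ[ℂ] B) : Prop where
  injective : Function.Injective j
  intertwines : ∀ a : A, β (j a) = j (α a)
  dense : closure (⋃ k : ℕ, (β.symm)^[k] '' Set.range j) = Set.univ

end Semicrossed

end

noncomputable section

namespace Semicrossed

/-! A matrix `P` of polynomials has the same norm in both products, because both norms are the
supremum over `N` of the norms of its finite sections. These are matrices over `A` alone: each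
polynomial `p` is replaced by the lower triangular `N × N` block with entries `α^j (p_{i-j})`, `j ≤
i`.

Upper bound (`cmNorm_polyEval_le`): a completely contractive `π` is automatically a ⋆-representation
(`map_star_of_contractive`), so `D = (1 - K K⋆)^{1/2}` commutes with `π(A)`. Compressing the finite
section by the column `(D K⋆^j)_{j<N}`, which is contractive by telescoping, gives `∑ K^m (1 -
K^{N-m} K⋆^{N-m}) π(p_m)`. For `‖K‖ < 1` this tends to the value of `p` at `(π, K)`; scaling `K` by
`r → 1` covers all contractions. No dilation of `K` is needed. Unitary covariant representations of
`(B, β)` are included by restricting along `j`.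

Lower bound (`cmNorm_map_finiteSection_le`): finite sections are compressions of shift-type
representations. Such representations exist on both sides, and the GNS representations of `A` or `B`
detect the norm.

Equality of norms yields the complete isometry on the closure
(`exists_completelyIsometric_extension`). For the C⋆-cover, `U^{n+l} j(a) (U^l j(c⋆))⋆ = U^n
β^{-l}(j(ac))`; an approximate unit of `A` and the density of `⋃ β^{-k}(j(A))` then give every `U^n
b` (`monomial_mem_of_isClosed`). -/

/-- The C⋆-norm on matrices over a C⋆-algebra indexed by an arbitrary finite type. -/
def cmNorm {ι E : Type*} [Fintype ι] [NonUnitalCStarAlgebra E] (M : Matrix ι ι E) : ℝ :=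
  letI := CStarAlgebra.spectralOrder E
  haveI := CStarAlgebra.spectralOrderedRing E
  ‖CStarMatrix.ofMatrix M‖

/-! ### Matrix norms under ⋆-homomorphisms. -/

section StarHom

variable {ι E F : Type*} [Fintype ι] [NonUnitalCStarAlgebra E] [NonUnitalCStarAlgebra F]

theorem cmNorm_nonneg (M : Matrix ι ι E) : 0 ≤ cmNorm M := by
  let _ := CStarAlgebra.spectralOrder E
  have := CStarAlgebra.spectralOrderedRing E
  exact norm_nonneg (CStarMatrix.ofMatrix M)

theorem continuous_cmNorm : Continuous (cmNorm : Matrix ι ι E → ℝ) := by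
  let _ := CStarAlgebra.spectralOrder E
  have := CStarAlgebra.spectralOrderedRing E
  exact continuous_norm.comp (CStarMatrix.ofMatrixL (A := E) (m := ι) (n := ι)).continuous

theorem cmNorm_map_le (f : E →⋆ₙₐ[ℂ] F) (M : Matrix ι ι E) : cmNorm (M.map f) ≤ cmNorm M := by
  let _ := CStarAlgebra.spectralOrder E
  have := CStarAlgebra.spectralOrderedRing E
  let _ := CStarAlgebra.spectralOrder F
  have := CStarAlgebra.spectralOrderedRing F
  exact NonUnitalStarAlgHom.norm_apply_le (CStarMatrix.mapₙₐ (n := ι) f) (CStarMatrix.ofMatrix M)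

theorem cmNorm_map_of_injective (f : E →⋆ₙₐ[ℂ] F) (hf : Function.Injective f)
    (M : Matrix ι ι E) : cmNorm (M.map f) = cmNorm M := by
  let _ := CStarAlgebra.spectralOrder E
  have := CStarAlgebra.spectralOrderedRing E
  let _ := CStarAlgebra.spectralOrder F
  have := CStarAlgebra.spectralOrderedRing F
  exact NonUnitalStarAlgHom.norm_map (CStarMatrix.mapₙₐ (n := ι) f)
    (CStarMatrix.map_injective hf) (CStarMatrix.ofMatrix M)

/-- A bound on the matrix norm may be checked along a jointly injective family. -/
theorem cmNorm_le_of_family {κ : Type*} {F : κ → Type*} [∀ i, NonUnitalCStarAlgebra (F i)]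
    (f : ∀ i, E →⋆ₙₐ[ℂ] F i) (hf : ∀ x, (∀ i, f i x = 0) → x = 0) (M : Matrix ι ι E)
    {c : ℝ} (hc : 0 ≤ c) (h : ∀ i, cmNorm (M.map (f i)) ≤ c) : cmNorm M ≤ c := by
  let _ := CStarAlgebra.spectralOrder E
  have := CStarAlgebra.spectralOrderedRing E
  let _ : ∀ i, PartialOrder (F i) := fun i => CStarAlgebra.spectralOrder (F i)
  have : ∀ i, StarOrderedRing (F i) := fun i => CStarAlgebra.spectralOrderedRing (F i)
  -- The amplifications assemble into one ⋆-homomorphism into a product; being injective, it is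
  -- isometric.
  let g : CStarMatrix ι ι E →⋆ₙₐ[ℂ] lp (fun i => CStarMatrix ι ι (F i)) ∞ :=
    { toFun := fun x => ⟨fun i => CStarMatrix.mapₙₐ (n := ι) (f i) x, memℓp_infty ⟨‖x‖, by
        rintro _ ⟨i, rfl⟩
        exact NonUnitalStarAlgHom.norm_apply_le (CStarMatrix.mapₙₐ (n := ι) (f i)) x⟩⟩
      map_smul' := fun c x => by
        refine lp.ext (funext fun i => ?_)
        exact map_smul (CStarMatrix.mapₙₐ (n := ι) (f i)) c x
      map_zero' := by
        refine lp.ext (funext fun i => ?_)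
        exact map_zero (CStarMatrix.mapₙₐ (n := ι) (f i))
      map_add' := fun x y => by
        refine lp.ext (funext fun i => ?_)
        exact map_add (CStarMatrix.mapₙₐ (n := ι) (f i)) x y
      map_mul' := fun x y => by
        refine lp.ext (funext fun i => ?_)
        exact map_mul (CStarMatrix.mapₙₐ (n := ι) (f i)) x y
      map_star' := fun x => by
        refine lp.ext (funext fun i => ?_)
        exact map_star (CStarMatrix.mapₙₐ (n := ι) (f i)) x }
  have hg : Function.Injective g := by
    rw [injective_iff_map_eq_zero]
    intro x hx
    ext k l
    refine hf _ fun i => ?_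
    have := congrArg (fun y : lp (fun i => CStarMatrix ι ι (F i)) ∞ => y i k l) hx
    exact this
  have e : ‖g (CStarMatrix.ofMatrix M)‖ = cmNorm M :=
    NonUnitalStarAlgHom.norm_map g hg (CStarMatrix.ofMatrix M)
  rw [← e]
  exact lp.norm_le_of_forall_le hc h

end StarHom

/-! ### Matrices of operators as operators on `Hⁿ`, and their sesquilinear forms. -/

section Operators

variable {ι H : Type*} [Fintype ι] [NormedAddCommGroup H] [InnerProductSpace ℂ H]

/-- The operator on `Hⁿ` given by a matrix of operators on `H`. -/
def matrixOp (M : Matrix ι ι (BH H)) : BH (PiLp 2 fun _ : ι => H) :=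
  ((PiLp.continuousLinearEquiv 2 ℂ fun _ : ι => H).symm : (ι → H) →L[ℂ] PiLp 2 fun _ : ι => H) ∘L
    ContinuousLinearMap.pi fun k => ∑ l, M k l ∘L PiLp.proj 2 (fun _ : ι => H) l

theorem matrixOp_apply (M : Matrix ι ι (BH H)) (x : PiLp 2 fun _ : ι => H) (k : ι) :
    matrixOp M x k = ∑ l, M k l (x l) := by
  simp [matrixOp]

variable [CompleteSpace H]

/-- `matrixOp` is an injective ⋆-homomorphism of C⋆-algebras, hence isometric. -/
theorem cmNorm_eq_norm_matrixOp (M : Matrix ι ι (BH H)) : cmNorm M = ‖matrixOp M‖ := by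
  classical
  let _ := CStarAlgebra.spectralOrder (BH H)
  have := CStarAlgebra.spectralOrderedRing (BH H)
  let g : CStarMatrix ι ι (BH H) →⋆ₙₐ[ℂ] BH (PiLp 2 fun _ : ι => H) :=
    { toFun := fun x => matrixOp (CStarMatrix.ofMatrix.symm x)
      map_smul' := fun c x => by
        ext v k
        simp [matrixOp_apply, Finset.smul_sum]
      map_zero' := by
        ext v k
        simp [matrixOp_apply]
      map_add' := fun x y => by
        ext v k
        simp [matrixOp_apply, Finset.sum_add_distrib]
      map_mul' := fun x y => by
        ext v k
        simp only [matrixOp_apply, mul_apply_eq_comp, map_sum,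
          CStarMatrix.ofMatrix_symm_apply, CStarMatrix.mul_apply, sum_apply]
        rw [Finset.sum_comm]
      map_star' := fun x => by
        refine (ContinuousLinearMap.eq_adjoint_iff _ _).2 fun v w => ?_
        simp only [PiLp.inner_apply, matrixOp_apply, sum_inner, inner_sum,
          CStarMatrix.ofMatrix_symm_apply, CStarMatrix.star_apply,
          ContinuousLinearMap.star_eq_adjoint, ContinuousLinearMap.adjoint_inner_left]
        rw [Finset.sum_comm] }
  refine (NonUnitalStarAlgHom.norm_map g ?_ (CStarMatrix.ofMatrix M)).symm
  rw [injective_iff_map_eq_zero]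
  intro x hx
  ext k l v
  have := congrArg (fun T : BH (PiLp 2 fun _ : ι => H) => T (PiLp.single 2 l v) k) hx
  change matrixOp (CStarMatrix.ofMatrix.symm x) _ k = _ at this
  simp only [matrixOp_apply] at this
  rw [Finset.sum_eq_single l] at this
  · simpa using this
  · intro b _ hb
    simp [hb]
  · simp

/-- Together with its converse below, this lets compressions be handled through inner products of
vectors, without building operators between direct sums. -/
theorem norm_sum_inner_le (M : Matrix ι ι (BH H)) (x y : ι → H) :
    ‖∑ k, ∑ l, inner ℂ (y k) (M k l (x l))‖ ≤
      cmNorm M * √(∑ l, ‖x l‖ ^ 2) * √(∑ k, ‖y k‖ ^ 2) := by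
  have h : ∑ k, ∑ l, inner ℂ (y k) (M k l (x l)) =
      inner ℂ (WithLp.toLp 2 y) (matrixOp M (WithLp.toLp 2 x)) := by
    simp [PiLp.inner_apply, matrixOp_apply, inner_sum]
  rw [h, cmNorm_eq_norm_matrixOp]
  refine (norm_inner_le_norm _ _).trans ?_
  rw [mul_comm]
  have hx : √(∑ l, ‖x l‖ ^ 2) = ‖(WithLp.toLp 2 x : PiLp 2 fun _ : ι => H)‖ := by
    rw [PiLp.norm_eq_of_L2]
  have hy : √(∑ l, ‖y l‖ ^ 2) = ‖(WithLp.toLp 2 y : PiLp 2 fun _ : ι => H)‖ := by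
    rw [PiLp.norm_eq_of_L2]
  rw [hx, hy]
  gcongr
  exact ContinuousLinearMap.le_opNorm _ _

theorem cmNorm_le_of_norm_sum_inner_le (M : Matrix ι ι (BH H)) {c : ℝ} (hc : 0 ≤ c)
    (h : ∀ x y : ι → H, ‖∑ k, ∑ l, inner ℂ (y k) (M k l (x l))‖ ≤
      c * √(∑ l, ‖x l‖ ^ 2) * √(∑ k, ‖y k‖ ^ 2)) : cmNorm M ≤ c := by
  rw [cmNorm_eq_norm_matrixOp]
  refine ContinuousLinearMap.opNorm_le_bound _ hc fun x => ?_
  -- Testing against `y = M x` recovers `‖M x‖²`.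
  have h1 := h x (matrixOp M x)
  have h2 : ∑ k, ∑ l, inner ℂ (matrixOp M x k) (M k l (x l)) =
      inner ℂ (matrixOp M x) (matrixOp M x) := by
    simp only [PiLp.inner_apply, matrixOp_apply, inner_sum]
  rw [h2, ← PiLp.norm_eq_of_L2, ← PiLp.norm_eq_of_L2, inner_self_eq_norm_sq_to_K] at h1
  simp only [norm_pow, Complex.coe_algebraMap, Complex.norm_real, norm_norm] at h1
  rcases (norm_nonneg (matrixOp M x)).eq_or_lt with h0 | h0
  · rw [← h0]; positivity
  · rw [sq] at h1
    exact le_of_mul_le_mul_right h1 h0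

end Operators

/-! ### Contractive homomorphisms preserve adjoints. -/

section Contraction

variable {H : Type*} [NormedAddCommGroup H] [InnerProductSpace ℂ H] [CompleteSpace H]

open ContinuousLinearMap in
-- Expanding the square with `T x = x` gives `‖T⋆x - x‖² = ‖T⋆x‖² - ‖x‖² ≤ 0`.
theorem adjoint_apply_eq_self_of_contraction {T : BH H} (hT : ‖T‖ ≤ 1) {x : H} (hx : T x = x) :
    adjoint T x = x := by
  have h1 : ‖adjoint T x‖ ≤ ‖x‖ := by
    have := (adjoint T).le_opNorm x
    rw [LinearIsometryEquiv.norm_map] at this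
    nlinarith [norm_nonneg x]
  have h2 : ‖adjoint T x - x‖ ^ 2 = ‖adjoint T x‖ ^ 2 - ‖x‖ ^ 2 := by
    rw [@norm_sub_sq ℂ, adjoint_inner_left, hx, inner_self_eq_norm_sq]
    ring
  have h3 : ‖adjoint T x - x‖ ^ 2 ≤ 0 := by
    rw [h2]
    nlinarith [norm_nonneg x, norm_nonneg (adjoint T x)]
  have h4 : ‖adjoint T x - x‖ = 0 := by
    nlinarith [norm_nonneg (adjoint T x - x)]
  exact sub_eq_zero.1 (norm_eq_zero.1 h4)

/-- If `T` lives on the fixed space of the contraction `E` and `‖E + i t T‖` is at most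
`1 + O(t²)`, then `T` is self-adjoint. -/
theorem isSelfAdjoint_of_norm_add_smul_le {E T : BH H} (hE : ‖E‖ ≤ 1) (hET : E * T = T)
    (hTE : T * E = T) {c : ℝ}
    (h : ∀ t : ℝ, ‖E + (Complex.I * t) • T‖ ^ 2 ≤ 1 + c * t ^ 2) : IsSelfAdjoint T := by
  have key : ∀ y, E y = y → (inner ℂ y (T y) : ℂ).im = 0 := by
    intro y hy
    have hb : ∀ t : ℝ, 0 ≤ c * ‖y‖ ^ 2 * (t * t) + 2 * (inner ℂ y (T y) : ℂ).im * t + 0 := by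
      intro t
      have h1 := (E + (Complex.I * t) • T).le_opNorm y
      have h2 : ‖(E + (Complex.I * t) • T) y‖ ^ 2 ≤ (1 + c * t ^ 2) * ‖y‖ ^ 2 := by
        calc _ ≤ (‖E + (Complex.I * t) • T‖ * ‖y‖) ^ 2 := by gcongr
          _ = ‖E + (Complex.I * t) • T‖ ^ 2 * ‖y‖ ^ 2 := by ring
          _ ≤ _ := by gcongr; exact h t
      have h3 : (E + (Complex.I * t) • T) y = y + (Complex.I * t) • T y := by
        simp [hy]
      rw [h3, @norm_add_sq ℂ] at h2
      have h4 : RCLike.re (inner ℂ y ((Complex.I * (t : ℂ)) • T y)) =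
          - (t * (inner ℂ y (T y) : ℂ).im) := by
        rw [inner_smul_right]
        simp
      rw [h4] at h2
      nlinarith [sq_nonneg ‖(Complex.I * (t : ℂ)) • T y‖]
    -- A quadratic in `t` that is nonnegative everywhere and has no constant term has no linear term
    -- either.
    have hd := discrim_le_zero hb
    rw [discrim] at hd
    nlinarith [sq_nonneg (inner ℂ y (T y) : ℂ).im]
  have hEs : ∀ y, E y = y ↔ ContinuousLinearMap.adjoint E y = y := by
    intro y
    refine ⟨adjoint_apply_eq_self_of_contraction hE, fun hy => ?_⟩
    have := adjoint_apply_eq_self_of_contraction (T := ContinuousLinearMap.adjoint E)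
      (by rwa [LinearIsometryEquiv.norm_map]) hy
    rwa [ContinuousLinearMap.adjoint_adjoint] at this
  -- `E` and `E⋆` have the same fixed space `F`. It contains the ranges of `T` and `T⋆`, so `T`
  -- vanishes on `Fᗮ` and only vectors of `F` matter for the quadratic form.
  let F : Submodule ℂ H := LinearMap.ker ((E - 1 : BH H) : H →ₗ[ℂ] H)
  have hF : ∀ y, y ∈ F ↔ E y = y := by
    intro y
    simp [F, sub_eq_zero]
  have : CompleteSpace F := (ContinuousLinearMap.isClosed_ker (E - 1 : BH H)).completeSpace_coe
  have hTF : ∀ y, T y ∈ F := fun y => (hF _).2 (DFunLike.congr_fun hET y)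
  have hT'F : ∀ y, ContinuousLinearMap.adjoint T y ∈ F := by
    intro y
    rw [hF, hEs]
    have := congrArg star hTE
    rw [star_mul] at this
    exact DFunLike.congr_fun this y
  rw [ContinuousLinearMap.isSelfAdjoint_iff_isSymmetric,
    LinearMap.isSymmetric_iff_inner_map_self_real]
  intro x
  obtain ⟨y, hy, z, hz, rfl⟩ := F.exists_add_mem_mem_orthogonal x
  have hTz : T z = 0 := by
    have : inner ℂ (T z) (T z) = 0 := by
      rw [← ContinuousLinearMap.adjoint_inner_left]
      exact hz _ (hT'F _)
    exact inner_self_eq_zero.1 this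
  have e : inner ℂ (T (y + z)) (y + z) = inner ℂ (T y) y := by
    rw [map_add, hTz, add_zero, inner_add_right, hz _ (hTF y), add_zero]
  change starRingEnd ℂ (inner ℂ (T (y + z)) (y + z)) = inner ℂ (T (y + z)) (y + z)
  rw [e, Complex.conj_eq_iff_im, ← inner_conj_symm, Complex.conj_im,
    key y ((hF y).1 hy), neg_zero]

end Contraction

section Approximants

variable {A : Type*} [NonUnitalCStarAlgebra A]

/-- Every self-adjoint element is a limit of self-adjoint elements that have a self-adjoint
contractive local unit. -/
theorem exists_localUnit_near {a : A} (ha : IsSelfAdjoint a) {δ : ℝ} (hδ : 0 < δ) :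
    ∃ b e : A, IsSelfAdjoint b ∧ IsSelfAdjoint e ∧ ‖e‖ ≤ 1 ∧ e * b = b ∧ b * e = b ∧
      ‖a - b‖ ≤ δ := by
  -- `g` is soft thresholding at `δ`, within `δ` of the identity; `f` equals `1` wherever `g` is
  -- nonzero.
  let f : ℝ → ℝ := fun x => min 1 (|x| / δ)
  let g : ℝ → ℝ := fun x => max (x - δ) 0 + min (x + δ) 0
  have hf : Continuous f := by fun_prop
  have hg : Continuous g := by fun_prop
  have hf0 : f 0 = 0 := by simp [f]
  have hg0 : g 0 = 0 := by simp [g, hδ.le]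
  have hfg : ∀ x, f x * g x = g x := by
    intro x
    by_cases h : |x| ≤ δ
    · have : g x = 0 := by
        obtain ⟨h1, h2⟩ := abs_le.1 h
        simp only [g]
        rw [max_eq_right (by linarith), min_eq_right (by linarith), add_zero]
      rw [this, mul_zero]
    · have : f x = 1 := min_eq_left ((one_le_div hδ).2 (not_le.1 h).le)
      rw [this, one_mul]
  refine ⟨cfcₙ g a, cfcₙ f a, cfcₙ_predicate g a, cfcₙ_predicate f a, ?_, ?_, ?_, ?_⟩
  · refine norm_cfcₙ_le fun x _ => ?_
    rw [Real.norm_eq_abs, abs_of_nonneg (by positivity)]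
    exact min_le_left _ _
  · rw [← cfcₙ_mul f g a hf.continuousOn hf0 hg.continuousOn hg0]
    simp only [hfg]
  · rw [← cfcₙ_mul g f a hg.continuousOn hg0 hf.continuousOn hf0]
    simp only [mul_comm (g _), hfg]
  · nth_rewrite 1 [← cfcₙ_id' ℝ a]
    rw [← cfcₙ_sub (fun x => x) g a continuous_id.continuousOn rfl hg.continuousOn hg0]
    refine norm_cfcₙ_le fun x _ => ?_
    rw [Real.norm_eq_abs, abs_le]
    simp only [g]
    rcases max_cases (x - δ) 0 with h | h <;> rcases min_cases (x + δ) 0 with h' | h' <;>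
      constructor <;> linarith

variable {H : Type*} [NormedAddCommGroup H] [InnerProductSpace ℂ H] [CompleteSpace H]

/-- A local unit `e` of `b` stands in for the identity: `‖e + itb‖² = ‖e² + t²b²‖ ≤ 1 + t²‖b‖²`, and
contractivity transfers this bound to `π e + it π b`. Density of such `b` finishes the argument. -/
theorem isSelfAdjoint_map_of_contractive (π : A →ₙₐ[ℂ] BH H) (hπ : ∀ a, ‖π a‖ ≤ ‖a‖) {a : A}
    (ha : IsSelfAdjoint a) : IsSelfAdjoint (π a) := by
  have hcont : Continuous π :=
    AddMonoidHomClass.continuous_of_bound π 1 fun x => by simpa using hπ x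
  have hcl : IsClosed {x : A | IsSelfAdjoint (π x)} :=
    isClosed_eq (continuous_star.comp hcont) hcont
  refine hcl.closure_subset_iff.2 (le_refl _) (Metric.mem_closure_iff.2 fun ε hε => ?_)
  obtain ⟨b, e, hb, he, he1, heb, hbe, hab⟩ := exists_localUnit_near ha (half_pos hε)
  refine ⟨b, ?_, by rw [dist_eq_norm]; linarith⟩
  refine isSelfAdjoint_of_norm_add_smul_le (E := π e) (c := ‖b‖ ^ 2) ((hπ e).trans he1)
    (by rw [← map_mul, heb]) (by rw [← map_mul, hbe]) fun t => ?_
  have h1 : ‖π e + (Complex.I * t) • π b‖ ≤ ‖e + (Complex.I * t) • b‖ := by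
    rw [← map_smul, ← map_add]
    exact hπ _
  have h2 : star (e + (Complex.I * t) • b) * (e + (Complex.I * t) • b) =
      e * e + ((t : ℂ) ^ 2) • (b * b) := by
    rw [star_add, star_smul, he.star_eq, hb.star_eq, add_mul, mul_add, mul_add,
      smul_mul_assoc, smul_mul_assoc, mul_smul_comm, mul_smul_comm, heb, hbe, smul_smul]
    have h3 : star (Complex.I * (t : ℂ)) = - (Complex.I * t) := by simp
    have h4 : star (Complex.I * (t : ℂ)) * (Complex.I * t) = (t : ℂ) ^ 2 := by
      rw [h3]
      linear_combination (-(t : ℂ) ^ 2) * Complex.I_sq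
    rw [h4, h3, neg_smul]
    abel
  calc ‖π e + (Complex.I * t) • π b‖ ^ 2 ≤ ‖e + (Complex.I * t) • b‖ ^ 2 := by gcongr
    _ = ‖e * e + ((t : ℂ) ^ 2) • (b * b)‖ := by rw [← h2, CStarRing.norm_star_mul_self, sq]
    _ ≤ ‖e‖ * ‖e‖ + t ^ 2 * (‖b‖ * ‖b‖) := by
      refine (norm_add_le _ _).trans (add_le_add (norm_mul_le _ _) ?_)
      rw [norm_smul, norm_pow, Complex.norm_real, Real.norm_eq_abs, sq_abs]
      gcongr
      exact norm_mul_le _ _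
    _ ≤ 1 + ‖b‖ ^ 2 * t ^ 2 := by nlinarith [norm_nonneg e]

/-- A contractive homomorphism of a C⋆-algebra into `B(H)` preserves adjoints. -/
theorem map_star_of_contractive (π : A →ₙₐ[ℂ] BH H) (hπ : ∀ a, ‖π a‖ ≤ ‖a‖) (a : A) :
    π (star a) = star (π a) := by
  have hr := (isSelfAdjoint_map_of_contractive π hπ (realPart a).2).star_eq
  have hi := (isSelfAdjoint_map_of_contractive π hπ (imaginaryPart a).2).star_eq
  have h1 := realPart_add_I_smul_imaginaryPart a
  have h2 : star a = (realPart a : A) - Complex.I • (imaginaryPart a : A) := by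
    conv_lhs => rw [← h1]
    rw [star_add, star_smul, (realPart a).2.star_eq, (imaginaryPart a).2.star_eq]
    simp [sub_eq_add_neg]
  rw [h2]
  conv_rhs => rw [← h1]
  rw [map_sub, map_add, map_smul, star_add, star_smul, hr, hi]
  simp [sub_eq_add_neg]

end Approximants

/-! ### Positive functionals and faithfulness of the GNS representations. -/

open scoped ComplexStarModule ComplexOrder in
/-- A nonzero positive element is detected by a positive functional. -/
theorem exists_positiveLinearMap_ne_zero {A : Type*} [NonUnitalCStarAlgebra A] [PartialOrder A]
    [StarOrderedRing A] {b : A} (hb : 0 ≤ b) (hb0 : b ≠ 0) : ∃ f : A →ₚ[ℂ] ℂ, f b ≠ 0 := by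
  have hconv : Convex ℝ {a : A | 0 ≤ a} := by
    intro x hx y hy s t hs ht _
    exact add_nonneg (smul_nonneg hs hx) (smul_nonneg ht hy)
  have hnot : -b ∉ {a : A | 0 ≤ a} := fun h =>
    hb0 (le_antisymm (neg_nonneg.1 h) hb)
  obtain ⟨f, u, hfu, hu⟩ := geometric_hahn_banach_point_closed hconv
    CStarAlgebra.isClosed_nonneg hnot
  have hu0 : u < 0 := by simpa using hu 0 (le_refl (0 : A))
  -- On a cone, a functional bounded below is nonnegative: if `f a < 0`, the multiple `(u / f a) •
  -- a` would attain the strict lower bound `u`.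
  have hf : ∀ a : A, 0 ≤ a → 0 ≤ f a := by
    intro a ha
    by_contra! h
    have h1 := hu ((u / f a) • a) (smul_nonneg (div_nonneg_of_nonpos hu0.le h.le) ha)
    rw [map_smul, smul_eq_mul, div_mul_cancel₀ _ h.ne] at h1
    exact lt_irrefl _ h1
  have hfb : 0 < f b := by
    rw [map_neg] at hfu
    linarith
  let g : A →ₗ[ℂ] ℂ :=
    { toFun := fun x => (f (ℜ x : A) : ℂ) + Complex.I * (f (ℑ x : A) : ℂ)
      map_add' := fun x y => by
        simp only [map_add, AddSubgroup.coe_add, Complex.ofReal_add]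
        ring
      map_smul' := fun z x => by
        simp only [realPart_smul, imaginaryPart_smul, AddSubgroupClass.coe_sub,
          AddSubgroup.coe_add, selfAdjoint.val_smul, map_sub, map_add, map_smul, smul_eq_mul,
          Complex.ofReal_add, Complex.ofReal_sub, Complex.ofReal_mul, RingHom.id_apply]
        conv_rhs => rw [← Complex.re_add_im z]
        linear_combination (-(z.im : ℂ) * (f (ℑ x : A) : ℂ)) * Complex.I_sq }
  have hg : ∀ x : A, IsSelfAdjoint x → g x = f x := by
    intro x hx
    change (f (ℜ x : A) : ℂ) + Complex.I * (f (ℑ x : A) : ℂ) = f x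
    rw [hx.coe_realPart, hx.imaginaryPart]
    simp
  refine ⟨PositiveLinearMap.mk₀ g fun x hx => ?_, ?_⟩
  · rw [hg x (IsSelfAdjoint.of_nonneg hx)]
    exact_mod_cast hf x hx
  · change g b ≠ 0
    rw [hg b (IsSelfAdjoint.of_nonneg hb)]
    exact_mod_cast hfb.ne'

open scoped ComplexOrder in
/-- The GNS representations of a C⋆-algebra are jointly faithful. -/
theorem exists_gns_ne_zero {A : Type u} [NonUnitalCStarAlgebra A] [PartialOrder A]
    [StarOrderedRing A] {x : A} (hx : x ≠ 0) :
    ∃ f : A →ₚ[ℂ] ℂ, f.gnsNonUnitalStarAlgHom x ≠ 0 := by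
  -- Without a unit, the test vector is the class of `star x`: `x` sends it to the class of `x *
  -- star x`, whose squared norm is `f (star (x * star x) * (x * star x))`.
  have h1 : x * star x ≠ 0 := fun h => hx (CStarRing.mul_star_self_eq_zero_iff x |>.1 h)
  have h2 : star (x * star x) * (x * star x) ≠ 0 := fun h =>
    h1 (CStarRing.star_mul_self_eq_zero_iff _ |>.1 h)
  obtain ⟨f, hf⟩ := exists_positiveLinearMap_ne_zero (star_mul_self_nonneg (x * star x)) h2
  refine ⟨f, fun h => hf ?_⟩
  have h3 := congrArg (fun T : f.GNS →L[ℂ] f.GNS => T (f.toPreGNS (star x) : f.GNS)) h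
  simp only [PositiveLinearMap.gnsNonUnitalStarAlgHom_apply_coe,
    PositiveLinearMap.leftMulMapPreGNS_apply, zero_apply] at h3
  have h4 : ‖f.toPreGNS (x * star x)‖ = 0 := by
    rw [← UniformSpace.Completion.norm_coe]
    simpa using congrArg norm h3
  rw [← f.ofPreGNS_toPreGNS (x * star x), ← f.preGNS_norm_sq, h4]
  simp

/-! ### Finite sections of matrices of polynomials. -/

section FiniteSections

open Filter Topology

section Polynomials

variable {A : Type*} [NonUnitalCStarAlgebra A]

/-- The value `∑ₘ Kᵐ π(pₘ)` of the polynomial `∑ₘ Vᵐ pₘ`. -/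
def polyEval {R : Type*} [Ring R] [Algebra ℂ R] (π : A →ₗ[ℂ] R) (K : R) : (ℕ →₀ A) →ₗ[ℂ] R :=
  Finsupp.lsum ℂ fun m => LinearMap.mulLeft ℂ (K ^ m) ∘ₗ π

@[simp]
theorem polyEval_single {R : Type*} [Ring R] [Algebra ℂ R] (π : A →ₗ[ℂ] R) (K : R) (m : ℕ)
    (a : A) : polyEval π K (Finsupp.single m a) = K ^ m * π a := by
  simp [polyEval]

theorem polyEval_eq_sum {R : Type*} [Ring R] [Algebra ℂ R] (π : A →ₗ[ℂ] R) (K : R)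
    (p : ℕ →₀ A) : polyEval π K p = ∑ m ∈ p.support, K ^ m * π (p m) := by
  simp [polyEval, Finsupp.sum]

variable (α : A →⋆ₙₐ[ℂ] A)

/-- The `(i, j)` entry of the compression of the polynomial `p` in the regular representation. -/
def sectionEntry (p : ℕ →₀ A) (i j : ℕ) : A := if j ≤ i then α^[j] (p (i - j)) else 0

/-- The finite section of size `N` of a matrix of polynomials. -/
def finiteSection {ι : Type*} (N : ℕ) (P : Matrix ι ι (ℕ →₀ A)) :
    Matrix (ι × Fin N) (ι × Fin N) A :=
  fun s t => sectionEntry α (P s.1 t.1) s.2 t.2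

theorem sectionEntry_add (p q : ℕ →₀ A) (i j : ℕ) :
    sectionEntry α (p + q) i j = sectionEntry α p i j + sectionEntry α q i j := by
  unfold sectionEntry
  split_ifs <;> simp [iterate_map_add]

theorem sectionEntry_zero (i j : ℕ) : sectionEntry α 0 i j = 0 := by
  unfold sectionEntry
  split_ifs <;> simp [iterate_map_zero]

theorem sectionEntry_single (m : ℕ) (a : A) (i j : ℕ) :
    sectionEntry α (Finsupp.single m a) i j = if i = j + m then α^[j] a else 0 := by
  unfold sectionEntry
  by_cases h : i = j + m
  · rw [if_pos h, if_pos (by omega), show i - j = m by omega, Finsupp.single_eq_same]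
  · rw [if_neg h]
    split_ifs with h'
    · rw [Finsupp.single_eq_of_ne (by omega), iterate_map_zero]
    · rfl

end Polynomials

/-! ### Upper bound: finite sections dominate every contractive covariant representation. -/

section Defect

variable {A : Type*} [NonUnitalCStarAlgebra A] {α : A →⋆ₙₐ[ℂ] A}
variable {H : Type*} [NormedAddCommGroup H] [InnerProductSpace ℂ H] [CompleteSpace H]

/-- The defect operator `(1 - K K⋆)^{1/2}`. -/
def defect (K : BH H) : BH H := CFC.sqrt (1 - K * star K)

theorem isSelfAdjoint_defect (K : BH H) : IsSelfAdjoint (defect K) :=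
  IsSelfAdjoint.of_nonneg (CFC.sqrt_nonneg _)

theorem defect_mul_self {K : BH H} (hK : ‖K‖ ≤ 1) : defect K * defect K = 1 - K * star K := by
  refine CFC.sqrt_mul_sqrt_self _ (sub_nonneg.2 ?_)
  refine (CStarAlgebra.norm_le_one_iff_of_nonneg _ (mul_star_self_nonneg K)).1 ?_
  rw [CStarRing.norm_self_mul_star]
  exact mul_le_one₀ hK (norm_nonneg _) hK

/-- The adjoint of the covariance relation, iterated; it relies on `π` preserving adjoints. -/
theorem star_pow_mul_map {π : A →⋆ₙₐ[ℂ] BH H} {K : BH H}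
    (hcov : ∀ a, π a * K = K * π (α a)) (j : ℕ) (a : A) :
    star K ^ j * π a = π (α^[j] a) * star K ^ j := by
  have h1 : ∀ a, star K * π a = π (α a) * star K := by
    intro a
    have := congrArg star (hcov (star a))
    simpa [star_mul, ← map_star] using this
  induction j generalizing a with
  | zero => simp
  | succ j ih =>
    rw [pow_succ, mul_assoc, h1, ← mul_assoc, ih, Function.iterate_succ_apply, mul_assoc,
      ← pow_succ]

/-- `K K⋆ π(a) = K π(α a) K⋆ = π(a) K K⋆`, and commutation passes to the square root by functional
calculus. -/
theorem commute_defect {π : A →⋆ₙₐ[ℂ] BH H} {K : BH H}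
    (hcov : ∀ a, π a * K = K * π (α a)) (a : A) : Commute (defect K) (π a) := by
  have h1 : star K * π a = π (α a) * star K := by
    simpa using star_pow_mul_map hcov 1 a
  have h2 : Commute (1 - K * star K) (π a) := by
    refine (Commute.one_left _).sub_left ?_
    change K * star K * π a = π a * (K * star K)
    rw [mul_assoc, h1, ← mul_assoc, ← mul_assoc, hcov]
  exact Commute.cfcₙ_nnreal h2 _

theorem sum_pow_defect {K : BH H} (hK : ‖K‖ ≤ 1) (n : ℕ) :
    ∑ j ∈ Finset.range n, K ^ j * (defect K * defect K) * star K ^ j =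
      1 - K ^ n * star K ^ n := by
  rw [defect_mul_self hK]
  induction n with
  | zero => simp
  | succ n ih =>
    rw [Finset.sum_range_succ, ih, pow_succ K, pow_succ' (star K)]
    noncomm_ring

/-- Contractivity of the column `(D K⋆^j)_j`: since `‖D v‖² = ‖v‖² - ‖K⋆ v‖²`, the sum telescopes.
-/
theorem sum_norm_defect_sq_le {K : BH H} (hK : ‖K‖ ≤ 1) (n : ℕ) (x : H) :
    ∑ j ∈ Finset.range n, ‖defect K ((star K ^ j) x)‖ ^ 2 ≤ ‖x‖ ^ 2 := by
  have h1 : ∀ v : H, ‖defect K v‖ ^ 2 = ‖v‖ ^ 2 - ‖star K v‖ ^ 2 := by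
    intro v
    have e1 : inner ℂ (defect K v) (defect K v) = inner ℂ ((1 - K * star K) v) v := by
      rw [← defect_mul_self hK]
      nth_rewrite 3 [← (isSelfAdjoint_defect K).star_eq]
      exact (ContinuousLinearMap.adjoint_inner_left _ _ _).symm
    have e2 : inner ℂ ((1 - K * star K) v) v =
        inner ℂ v v - inner ℂ (star K v) (star K v) := by
      rw [sub_apply, inner_sub_left]
      congr 1
      exact (ContinuousLinearMap.adjoint_inner_right K _ _).symm
    rw [e2] at e1
    simp only [inner_self_eq_norm_sq_to_K] at e1
    exact_mod_cast e1
  have h2 : ∀ n : ℕ, ∑ j ∈ Finset.range n, ‖defect K ((star K ^ j) x)‖ ^ 2 =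
      ‖x‖ ^ 2 - ‖(star K ^ n) x‖ ^ 2 := by
    intro n
    induction n with
    | zero => simp
    | succ n ih =>
      rw [Finset.sum_range_succ, ih, h1, pow_succ' (star K), mul_apply_eq_comp]
      ring
  rw [h2]
  nlinarith [sq_nonneg ‖(star K ^ n) x‖]

/-- The compression of the finite section by the defect columns. -/
theorem sum_defect_sectionEntry {π : A →⋆ₙₐ[ℂ] BH H} {K : BH H} (hK : ‖K‖ ≤ 1)
    (hcov : ∀ a, π a * K = K * π (α a)) (N : ℕ) (p : ℕ →₀ A) :
    ∑ i : Fin N, ∑ j : Fin N, K ^ (i : ℕ) * defect K * π (sectionEntry α p i j) *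
        (defect K * star K ^ (j : ℕ)) =
      p.sum fun m a => K ^ m * (1 - K ^ (N - m) * star K ^ (N - m)) * π a := by
  induction p using Finsupp.induction_linear with
  | zero => simp [sectionEntry_zero]
  | add p q hp hq =>
    rw [Finsupp.sum_add_index' (by simp) (by simp [mul_add]), ← hp, ← hq]
    simp only [sectionEntry_add, map_add, mul_add, add_mul, Finset.sum_add_distrib]
  | single m a =>
    rw [Finsupp.sum_single_index (by simp), ← sum_pow_defect hK, Finset.mul_sum,
      Finset.sum_mul, Finset.sum_comm]
    -- In column `j` only row `i = j + m` survives, and it lies in the section exactly when `j < N -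
    -- m`. For `m ≥ N` the truncated difference is `0` and both sides vanish.
    have h1 : ∀ j : Fin N, ∑ i : Fin N, K ^ (i : ℕ) * defect K *
        π (sectionEntry α (Finsupp.single m a) i j) * (defect K * star K ^ (j : ℕ)) =
        if (j : ℕ) < N - m then
          K ^ m * (K ^ (j : ℕ) * (defect K * defect K) * star K ^ (j : ℕ)) * π a else 0 := by
      intro j
      simp only [sectionEntry_single]
      split_ifs with hj
      · rw [Finset.sum_eq_single (⟨j + m, by omega⟩ : Fin N)]
        · rw [if_pos rfl, mul_assoc (K ^ m), mul_assoc _ _ (π a), star_pow_mul_map hcov,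
            pow_add K, ((Commute.refl K).pow_pow (j : ℕ) m).eq]
          simp only [mul_assoc]
          rw [← mul_assoc (π _) (defect K), ← (commute_defect hcov _).eq]
          simp only [mul_assoc]
        · intro i _ hi
          rw [if_neg fun h => hi (Fin.ext h)]
          simp
        · simp
      · refine Finset.sum_eq_zero fun i _ => ?_
        rw [if_neg (by omega)]
        simp
    rw [Finset.sum_congr rfl fun j _ => h1 j,
      Fin.sum_univ_eq_sum_range (fun j => if j < N - m then
          K ^ m * (K ^ j * (defect K * defect K) * star K ^ j) * π a else 0) N,
      ← Finset.sum_filter]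
    refine Finset.sum_congr ?_ fun _ _ => rfl
    ext j
    simp only [Finset.mem_filter, Finset.mem_range]
    omega

variable {ι : Type*} [Fintype ι]

/-- The truncated form is the form of the finite section evaluated at the vectors `D K⋆^j x_l`,
whose total norm is at most that of `x`. -/
theorem norm_sum_truncated_le {π : A →⋆ₙₐ[ℂ] BH H} {K : BH H} (hK : ‖K‖ ≤ 1)
    (hcov : ∀ a, π a * K = K * π (α a)) (N : ℕ) (P : Matrix ι ι (ℕ →₀ A)) (x y : ι → H) :
    ‖∑ k, ∑ l, inner ℂ (y k) (((P k l).sum fun m a =>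
      K ^ m * (1 - K ^ (N - m) * star K ^ (N - m)) * π a) (x l))‖ ≤
      cmNorm (finiteSection α N P) * √(∑ l, ‖x l‖ ^ 2) * √(∑ k, ‖y k‖ ^ 2) := by
  let w : (ι → H) → ι × Fin N → H := fun x s => defect K ((star K ^ (s.2 : ℕ)) (x s.1))
  have hw : ∀ x : ι → H, ∑ s, ‖w x s‖ ^ 2 ≤ ∑ l, ‖x l‖ ^ 2 := by
    intro x
    rw [Fintype.sum_prod_type]
    refine Finset.sum_le_sum fun l _ => ?_
    refine le_trans (le_of_eq ?_) (sum_norm_defect_sq_le hK N (x l))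
    exact Fin.sum_univ_eq_sum_range (fun j => ‖defect K ((star K ^ j) (x l))‖ ^ 2) N
  have h1 := norm_sum_inner_le ((finiteSection α N P).map π) (w x) (w y)
  have h2 : ∑ s, ∑ t, inner ℂ (w y s) ((finiteSection α N P).map π s t (w x t)) =
      ∑ k, ∑ l, inner ℂ (y k) (((P k l).sum fun m a =>
        K ^ m * (1 - K ^ (N - m) * star K ^ (N - m)) * π a) (x l)) := by
    simp only [← sum_defect_sectionEntry hK hcov, Fintype.sum_prod_type, sum_apply, inner_sum]
    refine Finset.sum_congr rfl fun k _ => ?_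
    rw [Finset.sum_comm]
    refine Finset.sum_congr rfl fun l _ => Finset.sum_congr rfl fun i _ =>
      Finset.sum_congr rfl fun j _ => ?_
    have e : ∀ (u v : H), inner ℂ (defect K ((star K ^ (i : ℕ)) u)) v =
        inner ℂ u ((K ^ (i : ℕ) * defect K) v) := by
      intro u v
      have : star (K ^ (i : ℕ) * defect K) = defect K * star K ^ (i : ℕ) := by
        rw [star_mul, (isSelfAdjoint_defect K).star_eq, star_pow]
      rw [← ContinuousLinearMap.adjoint_inner_left, ← ContinuousLinearMap.star_eq_adjoint, this]
      rfl
    exact e _ _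
  rw [h2] at h1
  refine h1.trans ?_
  gcongr
  · exact mul_nonneg (cmNorm_nonneg _) (Real.sqrt_nonneg _)
  · exact cmNorm_nonneg _
  · exact cmNorm_map_le π _
  · exact hw x
  · exact hw y

theorem norm_sum_polyEval_le_of_lt_one {π : A →⋆ₙₐ[ℂ] BH H} {K : BH H} (hK : ‖K‖ < 1)
    (hcov : ∀ a, π a * K = K * π (α a)) (P : Matrix ι ι (ℕ →₀ A)) {c : ℝ}
    (hP : ∀ N, cmNorm (finiteSection α N P) ≤ c) (x y : ι → H) :
    ‖∑ k, ∑ l, inner ℂ (y k) (polyEval (π : A →ₗ[ℂ] BH H) K (P k l) (x l))‖ ≤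
      c * √(∑ l, ‖x l‖ ^ 2) * √(∑ k, ‖y k‖ ^ 2) := by
  -- Strict contractivity makes the correction `K^{N-m} K⋆^{N-m}` vanish as `N → ∞`.
  have h0 : ∀ m : ℕ, Tendsto (fun N : ℕ => K ^ (N - m)) atTop (𝓝 0) := fun m =>
    (tendsto_pow_atTop_nhds_zero_of_norm_lt_one hK).comp (tendsto_sub_atTop_nat m)
  have h0' : ∀ m : ℕ, Tendsto (fun N : ℕ => star K ^ (N - m)) atTop (𝓝 0) := fun m =>
    (tendsto_pow_atTop_nhds_zero_of_norm_lt_one (by rwa [norm_star])).comp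
      (tendsto_sub_atTop_nat m)
  have h1 : ∀ p : ℕ →₀ A, Tendsto (fun N : ℕ => p.sum fun m a =>
      K ^ m * (1 - K ^ (N - m) * star K ^ (N - m)) * π a) atTop
      (𝓝 (polyEval (π : A →ₗ[ℂ] BH H) K p)) := by
    intro p
    rw [polyEval_eq_sum]
    refine tendsto_finsetSum _ fun m _ => ?_
    have := ((tendsto_const_nhds (x := K ^ m)).mul
      ((tendsto_const_nhds (x := (1 : BH H))).sub ((h0 m).mul (h0' m)))).mul_const (π (p m))
    simpa using this
  refine le_of_tendsto (f := fun N : ℕ => ‖∑ k, ∑ l, inner ℂ (y k) (((P k l).sum fun m a =>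
      K ^ m * (1 - K ^ (N - m) * star K ^ (N - m)) * π a) (x l))‖) (x := atTop) ?_
    (Eventually.of_forall fun N => (norm_sum_truncated_le hK.le hcov N P x y).trans ?_)
  · refine (tendsto_finsetSum _ fun k _ => tendsto_finsetSum _ fun l _ => ?_).norm
    exact (tendsto_const_nhds (x := y k)).inner
      (((ContinuousLinearMap.apply ℂ H (x l)).continuous.tendsto _).comp (h1 (P k l)))
  · gcongr
    exact hP N

/-- Finite sections control the norm in every contractive covariant representation. -/
theorem cmNorm_polyEval_le {π : A →⋆ₙₐ[ℂ] BH H} {K : BH H} (hK : ‖K‖ ≤ 1)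
    (hcov : ∀ a, π a * K = K * π (α a)) (P : Matrix ι ι (ℕ →₀ A)) {c : ℝ}
    (hP : ∀ N, cmNorm (finiteSection α N P) ≤ c) :
    cmNorm (P.map (polyEval (π : A →ₗ[ℂ] BH H) K)) ≤ c := by
  refine cmNorm_le_of_norm_sum_inner_le _ ((cmNorm_nonneg _).trans (hP 0)) fun x y => ?_
  -- Covariance is linear in `K`, so `(π, rK)` is again covariant, with `‖rK‖ < 1` for `0 < r < 1`;
  -- let `r → 1`.
  have hcont : Continuous fun r : ℝ => ‖∑ k, ∑ l, inner ℂ (y k)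
      (polyEval (π : A →ₗ[ℂ] BH H) ((r : ℂ) • K) (P k l) (x l))‖ := by
    simp only [polyEval_eq_sum, sum_apply, mul_apply_eq_comp, smul_pow, smul_apply]
    fun_prop
  have hlim : Tendsto _ (𝓝[<] (1 : ℝ)) _ := (hcont.tendsto 1).mono_left nhdsWithin_le_nhds
  simp only [Complex.ofReal_one, one_smul] at hlim
  refine le_of_tendsto hlim ?_
  filter_upwards [Ioo_mem_nhdsLT (show (0 : ℝ) < 1 from one_pos)] with r hr
  refine norm_sum_polyEval_le_of_lt_one ?_ (fun a => ?_) P hP x y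
  · rw [norm_smul, Complex.norm_real, Real.norm_eq_abs, abs_of_pos hr.1]
    nlinarith [norm_nonneg K, hr.1, hr.2]
  · rw [mul_smul_comm, hcov, smul_mul_assoc]

end Defect

/-! ### Lower bound: finite sections as compressions of shifts. -/

section Compression

variable {A : Type*} [NonUnitalCStarAlgebra A] {α : A →⋆ₙₐ[ℂ] A}
variable {H₀ H : Type*} [NormedAddCommGroup H₀] [InnerProductSpace ℂ H₀] [CompleteSpace H₀]
  [NormedAddCommGroup H] [InnerProductSpace ℂ H] [CompleteSpace H]
variable {ι : Type*} [Fintype ι]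

/-- Finite sections are compressions of representations of shift type. -/
theorem cmNorm_map_finiteSection_le (π : A →⋆ₙₐ[ℂ] BH H₀) (ρ : A →ₗ[ℂ] BH H) (K : BH H)
    (E : ℕ → H₀ →L[ℂ] H)
    (hE : ∀ i j x y, inner ℂ (E i x) (E j y) = if i = j then inner ℂ x y else (0 : ℂ))
    (hK : ∀ j x, K (E j x) = E (j + 1) x) (hρ : ∀ a j x, ρ a (E j x) = E j (π (α^[j] a) x))
    (N : ℕ) (P : Matrix ι ι (ℕ →₀ A)) :
    cmNorm ((finiteSection α N P).map π) ≤ cmNorm (P.map (polyEval ρ K)) := by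
  have hKm : ∀ m j x, (K ^ m) (E j x) = E (j + m) x := by
    intro m
    induction m with
    | zero => simp
    | succ m ih =>
      intro j x
      rw [pow_succ', mul_apply_eq_comp, ih, hK, add_assoc]
  have hentry : ∀ (p : ℕ →₀ A) (i j : ℕ) (x y : H₀),
      inner ℂ (E i y) (polyEval ρ K p (E j x)) = inner ℂ y (π (sectionEntry α p i j) x) := by
    intro p i j x y
    induction p using Finsupp.induction_linear with
    | zero => simp [sectionEntry_zero]
    | add p q hp hq =>
      rw [map_add, add_apply, inner_add_right, hp, hq, sectionEntry_add, map_add, add_apply,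
        inner_add_right]
    | single m a =>
      rw [polyEval_single, mul_apply_eq_comp, hρ, hKm, hE, sectionEntry_single]
      split_ifs <;> simp
  -- The `E j` are isometries with orthogonal ranges, so `w` preserves the total norm.
  let w : (ι × Fin N → H₀) → ι → H := fun x l => ∑ j : Fin N, E j (x (l, j))
  have hw : ∀ x, ∑ l, ‖w x l‖ ^ 2 = ∑ s, ‖x s‖ ^ 2 := by
    intro x
    rw [Fintype.sum_prod_type]
    refine Finset.sum_congr rfl fun l _ => ?_
    have : inner ℂ (w x l) (w x l) = ∑ j : Fin N, inner ℂ (x (l, j)) (x (l, j)) := by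
      simp only [w, sum_inner, inner_sum, hE, Fin.val_inj]
      simp
    simp only [inner_self_eq_norm_sq_to_K] at this
    exact_mod_cast this
  refine cmNorm_le_of_norm_sum_inner_le _ (cmNorm_nonneg _) fun x y => ?_
  have h1 := norm_sum_inner_le (P.map (polyEval ρ K)) (w x) (w y)
  rw [hw, hw] at h1
  refine le_trans (le_of_eq (congrArg norm ?_)) h1
  rw [Fintype.sum_prod_type]
  refine Finset.sum_congr rfl fun k _ => ?_
  simp only [w, map_sum, sum_inner, inner_sum, Matrix.map_apply, hentry, Fintype.sum_prod_type]
  rw [Finset.sum_comm]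
  exact Finset.sum_congr rfl fun l _ => Finset.sum_comm

end Compression

end FiniteSections

/-! ### Diagonal operators and the shift on `ℓ²(ℤ, H)`. -/

section BilateralShift

/-- The space `ℓ²(ℤ, H)`. -/
abbrev EllTwo (H : Type*) [NormedAddCommGroup H] : Type _ := lp (fun _ : ℤ => H) 2

variable {H : Type*} [NormedAddCommGroup H]

theorem memℓp_two_iff {f : ℤ → H} : Memℓp f 2 ↔ Summable fun k => ‖f k‖ ^ 2 := by
  simpa using memℓp_gen_iff (p := 2) (f := f) (by simp)

theorem memℓp_two_comp_equiv (e : ℤ ≃ ℤ) {f : ℤ → H} (hf : Memℓp f 2) :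
    Memℓp (fun k => f (e k)) 2 :=
  memℓp_two_iff.2 ((memℓp_two_iff.1 hf).comp_injective e.injective)

theorem memℓp_two_of_norm_le {C : ℝ} {f g : ℤ → H} (hf : Memℓp f 2) (h : ∀ k, ‖g k‖ ≤ C * ‖f k‖) :
    Memℓp g 2 := by
  rw [memℓp_two_iff] at hf ⊢
  refine (hf.mul_left (C ^ 2)).of_nonneg_of_le (fun _ => by positivity) fun k => ?_
  rw [← mul_pow]
  gcongr
  exact h k

theorem EllTwo.norm_sq_eq_tsum (x : EllTwo H) : ‖x‖ ^ 2 = ∑' k, ‖x k‖ ^ 2 := by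
  have := lp.norm_rpow_eq_tsum (p := 2) (by simp) x
  simpa using this

theorem EllTwo.summable_norm_sq (x : EllTwo H) : Summable fun k => ‖x k‖ ^ 2 :=
  memℓp_two_iff.1 (lp.memℓp x)

theorem EllTwo.norm_le_of_norm_le {C : ℝ} (hC : 0 ≤ C) {x y : EllTwo H}
    (h : ∀ k, ‖y k‖ ≤ C * ‖x k‖) : ‖y‖ ≤ C * ‖x‖ := by
  refine le_of_sq_le_sq ?_ (by positivity)
  rw [mul_pow, norm_sq_eq_tsum, norm_sq_eq_tsum, ← tsum_mul_left]
  refine y.summable_norm_sq.tsum_le_tsum (fun k => ?_) (x.summable_norm_sq.mul_left _)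
  rw [← mul_pow]
  gcongr
  exact h k

variable [InnerProductSpace ℂ H]

/-- A bounded family of operators acts diagonally on `ℓ²(ℤ, H)`. -/
def diagonalOp (T : ℤ → BH H) (C : ℝ) (hC : 0 ≤ C) (hT : ∀ k, ‖T k‖ ≤ C) : BH (EllTwo H) :=
  LinearMap.mkContinuous
    { toFun := fun x => ⟨fun k => T k (x k), memℓp_two_of_norm_le (lp.memℓp x) fun k =>
        (T k).le_of_opNorm_le (hT k) _⟩
      map_add' := fun _ _ => lp.ext (funext fun k => map_add (T k) _ _)
      map_smul' := fun _ _ => lp.ext (funext fun k => map_smul (T k) _ _) } C fun _ =>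
    EllTwo.norm_le_of_norm_le hC fun k => (T k).le_of_opNorm_le (hT k) _

@[simp]
theorem diagonalOp_apply (T : ℤ → BH H) (C : ℝ) (hC : 0 ≤ C) (hT : ∀ k, ‖T k‖ ≤ C)
    (x : EllTwo H) (k : ℤ) : diagonalOp T C hC hT x k = T k (x k) := rfl

variable (H) in
/-- The bilateral shift on `ℓ²(ℤ, H)`. -/
def bilateralShift : EllTwo H ≃ₗᵢ[ℂ] EllTwo H where
  toFun x := ⟨fun k => x (k - 1), memℓp_two_comp_equiv (Equiv.subRight (1 : ℤ)) (lp.memℓp x)⟩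
  map_add' _ _ := rfl
  map_smul' _ _ := rfl
  invFun x := ⟨fun k => x (k + 1), memℓp_two_comp_equiv (Equiv.addRight (1 : ℤ)) (lp.memℓp x)⟩
  left_inv x := lp.ext (funext fun k => congrArg (x : ℤ → H) (add_sub_cancel_right k 1))
  right_inv x := lp.ext (funext fun k => congrArg (x : ℤ → H) (sub_add_cancel k 1))
  norm_map' x := by
    refine (sq_eq_sq₀ (norm_nonneg _) (norm_nonneg _)).1 ?_
    rw [EllTwo.norm_sq_eq_tsum, EllTwo.norm_sq_eq_tsum]
    exact (Equiv.subRight (1 : ℤ)).tsum_eq fun k => ‖x k‖ ^ 2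

@[simp]
theorem bilateralShift_apply (x : EllTwo H) (k : ℤ) : bilateralShift H x k = x (k - 1) := rfl

variable (H) in
/-- The inclusion of `H` as the coordinate `j` of `ℓ²(ℤ, H)`. -/
def coordinateInclusion (j : ℤ) : H →L[ℂ] EllTwo H := lp.singleContinuousLinearMap ℂ (fun _ : ℤ => H) 2 j

theorem coordinateInclusion_apply (j : ℤ) (x : H) (k : ℤ) :
    coordinateInclusion H j x k = if k = j then x else 0 := by
  simp [coordinateInclusion, lp.single_apply, Pi.single_apply]

theorem inner_coordinateInclusion (i j : ℤ) (x y : H) :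
    inner ℂ (coordinateInclusion H i x) (coordinateInclusion H j y) =
      if i = j then inner ℂ x y else (0 : ℂ) := by
  change inner ℂ (lp.single 2 i x) (coordinateInclusion H j y) = _
  rw [lp.inner_single_left, coordinateInclusion_apply]
  split_ifs <;> simp

theorem bilateralShift_coordinateInclusion (j : ℤ) (x : H) :
    bilateralShift H (coordinateInclusion H j x) = coordinateInclusion H (j + 1) x := by
  ext k
  rw [bilateralShift_apply, coordinateInclusion_apply, coordinateInclusion_apply]
  simp only [sub_eq_iff_eq_add]

variable [CompleteSpace H]

/-- The diagonal representation given by a sequence of representations. -/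
def diagonalRep {A : Type*} [NonUnitalCStarAlgebra A] (τ : ℤ → A →⋆ₙₐ[ℂ] BH H) :
    A →⋆ₙₐ[ℂ] BH (EllTwo H) where
  toFun a := diagonalOp (fun k => τ k a) ‖a‖ (norm_nonneg a) fun k =>
    NonUnitalStarAlgHom.norm_apply_le (τ k) a
  map_smul' c a := by
    ext x k
    simp
  map_zero' := by
    ext x k
    simp
  map_add' a b := by
    ext x k
    simp
  map_mul' a b := by
    ext x k
    simp
  map_star' a := by
    refine (ContinuousLinearMap.eq_adjoint_iff _ _).2 fun x y => ?_
    rw [lp.inner_eq_tsum, lp.inner_eq_tsum]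
    refine tsum_congr fun k => ?_
    rw [diagonalOp_apply, diagonalOp_apply, map_star, ContinuousLinearMap.star_eq_adjoint,
      ContinuousLinearMap.adjoint_inner_left]

theorem diagonalRep_apply {A : Type*} [NonUnitalCStarAlgebra A] (τ : ℤ → A →⋆ₙₐ[ℂ] BH H) (a : A)
    (x : EllTwo H) (k : ℤ) : diagonalRep τ a x k = τ k a (x k) := rfl

theorem diagonalRep_coordinateInclusion {A : Type*} [NonUnitalCStarAlgebra A]
    (τ : ℤ → A →⋆ₙₐ[ℂ] BH H) (a : A) (j : ℤ) (x : H) :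
    diagonalRep τ a (coordinateInclusion H j x) = coordinateInclusion H j (τ j a x) := by
  ext k
  rw [diagonalRep_apply, coordinateInclusion_apply, coordinateInclusion_apply]
  split_ifs with h <;> simp [h]

end BilateralShift

/-! ### Regular representations of `(B, β)` and `(A, α)`. -/

section RegularRepresentations

/-- The regular representation of `(B, β)` on `ℓ²(ℤ, H)` induced by a representation of `B`. -/
def regularCovRep {B : Type u} [NonUnitalCStarAlgebra B] (β : B ≃⋆ₐ[ℂ] B) {H : Type u}
    [NormedAddCommGroup H] [InnerProductSpace ℂ H] [CompleteSpace H] (σ : B →⋆ₙₐ[ℂ] BH H) :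
    UnitaryCovRep β where
  H := EllTwo H
  σ := diagonalRep fun k => σ.comp ((β ^ k : B ≃⋆ₐ[ℂ] B) : B →⋆ₙₐ[ℂ] B)
  U := Unitary.linearIsometryEquiv.symm (bilateralShift H)
  covariance b := by
    ext x k
    change σ ((β ^ k) b) (x (k - 1)) = σ ((β ^ (k - 1)) (β b)) (x (k - 1))
    have : (β ^ (k - 1)) (β b) = (β ^ k) b := by
      change ((β ^ (k - 1)) * β) b = _
      rw [← zpow_add_one, sub_add_cancel]
    rw [this]

variable {A : Type u} [NonUnitalCStarAlgebra A] (α : A →⋆ₙₐ[ℂ] A) {H : Type u}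
    [NormedAddCommGroup H] [InnerProductSpace ℂ H] [CompleteSpace H]

/-- The representations `π αᵏ` for `k ≥ 0`, extended by zero. -/
def forwardReps (π : A →⋆ₙₐ[ℂ] BH H) : ℤ → A →⋆ₙₐ[ℂ] BH H
  | Int.ofNat n => π.comp (α ^ n)
  | Int.negSucc _ => 0

/-- The regular contractive covariant representation of `(A, α)` induced by a representation of
`A`; the contraction is the unilateral shift. -/
def regularContractiveCovRep (π : A →⋆ₙₐ[ℂ] BH H) : ContractiveCovRep α where
  H := EllTwo H
  π := (diagonalRep (forwardReps α π) : A →ₙₐ[ℂ] BH (EllTwo H))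
  cc := fun _ M => cmNorm_map_le (diagonalRep (forwardReps α π)) M
  -- The projection kills negative coordinates before shifting. Otherwise covariance fails at
  -- coordinate `0`, where `π(a)K` would see `x (-1)` while `Kπ(α a)` gives `0`.
  K := (bilateralShift H : BH (EllTwo H)) *
    diagonalOp (fun k => if 0 ≤ k then 1 else 0) 1 zero_le_one fun k => by
      split_ifs
      · exact ContinuousLinearMap.norm_id_le
      · simp
  norm_K_le := by
    refine (norm_mul_le _ _).trans (mul_le_one₀ ?_ (norm_nonneg _) ?_)
    · exact (bilateralShift H).toLinearIsometry.norm_toContinuousLinearMap_le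
    · exact LinearMap.mkContinuous_norm_le _ zero_le_one _
  covariance a := by
    ext x k
    change forwardReps α π k a ((if 0 ≤ k - 1 then (1 : BH H) else 0) (x (k - 1))) =
      (if 0 ≤ k - 1 then (1 : BH H) else 0) (forwardReps α π (k - 1) (α a) (x (k - 1)))
    split_ifs with h
    · obtain ⟨n, rfl⟩ : ∃ n : ℕ, k = Int.ofNat (n + 1) := ⟨(k - 1).toNat, by
        simp only [Int.ofNat_eq_natCast]
        omega⟩
      have e : Int.ofNat (n + 1) - 1 = Int.ofNat n := by simp
      rw [e]
      change π ((α ^ (n + 1)) a) _ = π ((α ^ n) (α a)) _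
      rw [pow_succ]
      rfl
    · simp

end RegularRepresentations

/-! ### Testing norms coordinatewise and in GNS representations. -/

section Evaluation

variable {κ : Type*} {E : κ → Type*} [∀ i, NonUnitalCStarAlgebra (E i)]

/-- The coordinate homomorphisms of a product of C⋆-algebras. -/
def lpEval (i : κ) : lp E ∞ →⋆ₙₐ[ℂ] E i where
  toFun x := x i
  map_smul' _ _ := rfl
  map_zero' := rfl
  map_add' _ _ := rfl
  map_mul' _ _ := rfl
  map_star' _ := rfl

theorem cmNorm_le_of_lpEval {ι : Type*} [Fintype ι] (M : Matrix ι ι (lp E ∞)) {c : ℝ}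
    (hc : 0 ≤ c) (h : ∀ i, cmNorm (M.map (lpEval i)) ≤ c) : cmNorm M ≤ c :=
  cmNorm_le_of_family lpEval (fun _ hx => lp.ext (funext hx)) M hc h

end Evaluation

/-- Finite sections can be estimated in the GNS representations of an ambient algebra. -/
theorem cmNorm_le_of_gns {A : Type*} {B : Type v} [NonUnitalCStarAlgebra A]
    [NonUnitalCStarAlgebra B] (j : A →⋆ₙₐ[ℂ] B) (hj : Function.Injective j) {ι : Type*} [Fintype ι]
    (M : Matrix ι ι A) {c : ℝ} (hc : 0 ≤ c)
    (h : ∀ (H : Type v) [NormedAddCommGroup H] [InnerProductSpace ℂ H] [CompleteSpace H]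
      (σ : B →⋆ₙₐ[ℂ] BH H), cmNorm (M.map (σ.comp j)) ≤ c) : cmNorm M ≤ c := by
  let _ := CStarAlgebra.spectralOrder B
  have := CStarAlgebra.spectralOrderedRing B
  refine cmNorm_le_of_family (fun f => (PositiveLinearMap.gnsNonUnitalStarAlgHom f).comp j)
    (fun x hx => ?_) M hc fun f => h _ _
  by_contra hne
  obtain ⟨f, hf⟩ := exists_gns_ne_zero (x := j x)
    fun h0 => hne (hj (h0.trans (map_zero j).symm))
  exact hf (hx f)

/-! ### Norms of polynomials in the semicrossed product. -/

section SemicrossedPoly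

variable {A : Type u} [NonUnitalCStarAlgebra A] (α : A →⋆ₙₐ[ℂ] A)

/-- The polynomial `∑ₘ Vᵐ pₘ` in the universal contractive covariant representation. -/
def semicrossedPoly : (ℕ →₀ A) →ₗ[ℂ] SemicrossedAmbient α :=
  Finsupp.lsum ℂ fun m =>
    { toFun := semicrossedMonomial α m
      map_add' := fun a b => lp.ext (funext fun ρ => by
        change ρ.K ^ m * ρ.π (a + b) = ρ.K ^ m * ρ.π a + ρ.K ^ m * ρ.π b
        rw [map_add, mul_add])
      map_smul' := fun c a => lp.ext (funext fun ρ => by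
        change ρ.K ^ m * ρ.π (c • a) = c • (ρ.K ^ m * ρ.π a)
        rw [map_smul, mul_smul_comm]) }

@[simp]
theorem semicrossedPoly_single (m : ℕ) (a : A) :
    semicrossedPoly α (Finsupp.single m a) = semicrossedMonomial α m a := by
  rw [semicrossedPoly, Finsupp.lsum_single]
  rfl

theorem semicrossedPoly_apply (p : ℕ →₀ A) (ρ : ContractiveCovRep α) :
    semicrossedPoly α p ρ = polyEval (ρ.π : A →ₗ[ℂ] BH ρ.H) ρ.K p := by
  induction p using Finsupp.induction_linear with
  | zero => simp
  | add p q hp hq => rw [map_add, map_add, ← hp, ← hq]; rfl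
  | single m a => rw [semicrossedPoly_single, polyEval_single]; rfl

theorem semicrossedMonomial_mul (m n : ℕ) (a b : A) :
    semicrossedMonomial α m a * semicrossedMonomial α n b =
      semicrossedMonomial α (m + n) (α^[n] a * b) := by
  refine lp.ext (funext fun ρ => ?_)
  change ρ.K ^ m * ρ.π a * (ρ.K ^ n * ρ.π b) = ρ.K ^ (m + n) * ρ.π (α^[n] a * b)
  have h : ∀ n a, ρ.π a * ρ.K ^ n = ρ.K ^ n * ρ.π (α^[n] a) := by
    intro n
    induction n with
    | zero => simp
    | succ n ih =>
      intro a
      rw [pow_succ, ← mul_assoc, ih, mul_assoc, ρ.covariance, ← mul_assoc,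
        Function.iterate_succ_apply']
  rw [map_mul, pow_add, mul_assoc (ρ.K ^ m), ← mul_assoc (ρ.π a), h]
  simp only [mul_assoc]

variable {ι : Type*} [Fintype ι]

theorem cmNorm_semicrossedPoly_le (P : Matrix ι ι (ℕ →₀ A)) {c : ℝ}
    (hP : ∀ N, cmNorm (finiteSection α N P) ≤ c) : cmNorm (P.map (semicrossedPoly α)) ≤ c := by
  refine cmNorm_le_of_lpEval _ ((cmNorm_nonneg _).trans (hP 0)) fun ρ => ?_
  -- Contractivity upgrades `ρ.π` to a ⋆-representation, as the defect argument requires.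
  let π' : A →⋆ₙₐ[ℂ] BH ρ.H :=
    { ρ.π with map_star' := map_star_of_contractive ρ.π ρ.cc.norm_le }
  have := cmNorm_polyEval_le (π := π') ρ.norm_K_le ρ.covariance P hP
  refine le_of_eq_of_le (congrArg cmNorm ?_) this
  exact Matrix.ext fun k l => semicrossedPoly_apply α (P k l) ρ

theorem cmNorm_finiteSection_le_semicrossedPoly (N : ℕ) (P : Matrix ι ι (ℕ →₀ A)) :
    cmNorm (finiteSection α N P) ≤ cmNorm (P.map (semicrossedPoly α)) := by
  refine cmNorm_le_of_gns (NonUnitalStarAlgHom.id ℂ A) Function.injective_id _ (cmNorm_nonneg _)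
    fun H _ _ _ π => ?_
  let ρ := regularContractiveCovRep α π
  have h1 := cmNorm_map_finiteSection_le (α := α) π (ρ.π : A →ₗ[ℂ] BH ρ.H) ρ.K
    (fun j => coordinateInclusion H j)
    (fun i j x y => (inner_coordinateInclusion _ _ x y).trans (by simp only [Nat.cast_inj]))
    (fun j x => by
      change bilateralShift H (diagonalOp _ _ _ _ (coordinateInclusion H j x)) = _
      have : diagonalOp (fun k : ℤ => if 0 ≤ k then (1 : BH H) else 0) 1 zero_le_one
          (fun k => by
            split_ifs
            · exact ContinuousLinearMap.norm_id_le
            · simp) (coordinateInclusion H j x) = coordinateInclusion H j x := by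
        ext k
        rw [diagonalOp_apply, coordinateInclusion_apply]
        split_ifs with h h' h' <;> simp
        omega
      rw [this, bilateralShift_coordinateInclusion]
      rfl)
    (fun a j x => by
      refine (diagonalRep_coordinateInclusion (forwardReps α π) a j x).trans ?_
      have : (α ^ j) a = α^[j] a := by
        rw [hom_coe_pow (F := A →⋆ₙₐ[ℂ] A) (fun f => ⇑f) rfl fun _ _ => rfl]
      rw [← this]
      rfl) N P
  refine h1.trans (le_of_eq_of_le (congrArg cmNorm ?_)
    (cmNorm_map_le (lpEval ρ) (P.map (semicrossedPoly α))))
  exact Matrix.ext fun k l => (semicrossedPoly_apply α (P k l) ρ).symm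

end SemicrossedPoly

/-! ### Norms of polynomials in the crossed product. -/

section CrossedPoly

variable {A : Type u} {B : Type v} [NonUnitalCStarAlgebra A] [NonUnitalCStarAlgebra B]
  (α : A →⋆ₙₐ[ℂ] A) (β : B ≃⋆ₐ[ℂ] B) (j : A →⋆ₙₐ[ℂ] B)

/-- The monomial `Uⁿ b` as a linear function of `b`. -/
def crossedMonomialₗ (n : ℤ) : B →ₗ[ℂ] CrossedProduct β where
  toFun := CrossedProduct.monomial β n
  map_add' a b := Subtype.ext <| lp.ext <| funext fun τ => by
    change ((τ.U ^ n : unitary (BH τ.H)) : BH τ.H) * τ.σ (a + b) = (τ.U ^ n : unitary (BH τ.H)) *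
      τ.σ a + (τ.U ^ n : unitary (BH τ.H)) * τ.σ b
    rw [map_add, mul_add]
  map_smul' c a := Subtype.ext <| lp.ext <| funext fun τ => by
    change ((τ.U ^ n : unitary (BH τ.H)) : BH τ.H) * τ.σ (c • a) =
      c • ((τ.U ^ n : unitary (BH τ.H)) * τ.σ a)
    rw [map_smul, mul_smul_comm]

theorem crossedMonomialₗ_apply (n : ℤ) (b : B) :
    crossedMonomialₗ β n b = CrossedProduct.monomial β n b := rfl

theorem norm_crossedMonomialₗ_le (n : ℤ) (b : B) : ‖crossedMonomialₗ β n b‖ ≤ ‖b‖ := by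
  refine lp.norm_le_of_forall_le (norm_nonneg b) fun τ => ?_
  change ‖((τ.U ^ n : unitary (BH τ.H)) : BH τ.H) * τ.σ b‖ ≤ ‖b‖
  rw [CStarRing.norm_coe_unitary_mul]
  exact NonUnitalStarAlgHom.norm_apply_le τ.σ b

theorem continuous_crossedMonomialₗ (n : ℤ) : Continuous (crossedMonomialₗ β n) :=
  AddMonoidHomClass.continuous_of_bound _ 1 fun b => by
    simpa using norm_crossedMonomialₗ_le β n b

/-- The polynomial `∑ₘ Uᵐ j(pₘ)` in the crossed product. -/
def crossedPoly : (ℕ →₀ A) →ₗ[ℂ] CrossedProduct β :=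
  Finsupp.lsum ℂ fun m => crossedMonomialₗ β (m : ℤ) ∘ₗ (j : A →ₗ[ℂ] B)

@[simp]
theorem crossedPoly_single (m : ℕ) (a : A) :
    crossedPoly β j (Finsupp.single m a) = CrossedProduct.monomial β (m : ℤ) (j a) := by
  rw [crossedPoly, Finsupp.lsum_single]
  rfl

theorem UnitaryCovRep.map_mul_zpow {β : B ≃⋆ₐ[ℂ] B} (τ : UnitaryCovRep β) (n : ℤ) (b : B) :
    τ.σ b * (τ.U ^ n : unitary (BH τ.H)) = (τ.U ^ n : unitary (BH τ.H)) * τ.σ ((β ^ n) b) := by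
  have h1 : ∀ b, τ.σ b * (τ.U⁻¹ : unitary (BH τ.H)) =
      (τ.U⁻¹ : unitary (BH τ.H)) * τ.σ (β⁻¹ b) := by
    intro b
    have h := τ.covariance (β⁻¹ b)
    rw [show β (β⁻¹ b) = b from β.apply_symm_apply b] at h
    calc τ.σ b * (τ.U⁻¹ : unitary (BH τ.H))
        = ((τ.U⁻¹ : unitary (BH τ.H)) : BH τ.H) * ((τ.U : BH τ.H) * τ.σ b) *
            (τ.U⁻¹ : unitary (BH τ.H)) := by
          rw [← mul_assoc, ← Submonoid.coe_mul, inv_mul_cancel, Submonoid.coe_one, one_mul]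
      _ = _ := by
          rw [← h, mul_assoc, mul_assoc, ← Submonoid.coe_mul, mul_inv_cancel,
            Submonoid.coe_one, mul_one]
  induction n generalizing b with
  | zero => simp
  | succ n ih =>
    rw [zpow_add_one, Submonoid.coe_mul, ← mul_assoc, ih, mul_assoc, τ.covariance, ← mul_assoc,
      add_comm, zpow_add, zpow_one, StarAlgEquiv.mul_apply]
  | pred n ih =>
    rw [zpow_sub_one, Submonoid.coe_mul, ← mul_assoc, ih, mul_assoc, h1, ← mul_assoc,
      sub_eq_neg_add, zpow_add, zpow_neg_one, StarAlgEquiv.mul_apply]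

theorem CrossedProduct.monomial_mul (m n : ℤ) (a b : B) :
    CrossedProduct.monomial β m a * CrossedProduct.monomial β n b =
      CrossedProduct.monomial β (m + n) ((β ^ n) a * b) := by
  refine Subtype.ext (lp.ext (funext fun τ => ?_))
  change ((τ.U ^ m : unitary (BH τ.H)) : BH τ.H) * τ.σ a * ((τ.U ^ n : unitary (BH τ.H)) * τ.σ b) =
    (τ.U ^ (m + n) : unitary (BH τ.H)) * τ.σ ((β ^ n) a * b)
  rw [map_mul, zpow_add, Submonoid.coe_mul, mul_assoc, ← mul_assoc (τ.σ a), τ.map_mul_zpow]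
  simp only [mul_assoc]

theorem CrossedProduct.star_monomial (n : ℤ) (b : B) :
    star (CrossedProduct.monomial β n b) =
      CrossedProduct.monomial β (-n) ((β ^ (-n)) (star b)) := by
  refine Subtype.ext (lp.ext (funext fun τ => ?_))
  change star (((τ.U ^ n : unitary (BH τ.H)) : BH τ.H) * τ.σ b) =
    (τ.U ^ (-n) : unitary (BH τ.H)) * τ.σ ((β ^ (-n)) (star b))
  rw [star_mul, ← τ.map_mul_zpow, map_star, zpow_neg]
  rfl

variable {α β j}

theorem zpow_map_eq (hj : ∀ a, β (j a) = j (α a)) (n : ℕ) (a : A) :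
    (β ^ (n : ℤ)) (j a) = j (α^[n] a) := by
  rw [zpow_natCast, StarAlgEquiv.coe_pow]
  exact (Function.Semiconj.iterate_right (f := j) (ga := α) (gb := β)
    (fun a => (hj a).symm) n a).symm

theorem crossedPoly_apply (p : ℕ →₀ A) (τ : UnitaryCovRep β) :
    (crossedPoly β j p : CrossedAmbient β) τ =
      polyEval ((τ.σ.comp j : A →⋆ₙₐ[ℂ] BH τ.H) : A →ₗ[ℂ] BH τ.H) (τ.U : BH τ.H) p := by
  induction p using Finsupp.induction_linear with
  | zero => rw [LinearMap.map_zero, LinearMap.map_zero]; rfl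
  | add p q hp hq => rw [map_add, map_add, ← hp, ← hq]; rfl
  | single m a =>
    rw [crossedPoly_single, polyEval_single]
    change ((τ.U ^ (m : ℤ) : unitary (BH τ.H)) : BH τ.H) * τ.σ (j a) = _
    rw [zpow_natCast]
    rfl

variable {ι : Type*} [Fintype ι]

/-- The inclusion of the crossed product into its ambient C⋆-algebra. -/
def crossedSubtype (β : B ≃⋆ₐ[ℂ] B) : CrossedProduct β →⋆ₙₐ[ℂ] CrossedAmbient β :=
  NonUnitalStarSubalgebraClass.subtype (CrossedProduct β)

/-- `(σ ∘ j, U)` is a contractive covariant pair for `(A, α)`, so the same upper bound applies. -/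
theorem cmNorm_crossedPoly_le (hj : ∀ a, β (j a) = j (α a)) (P : Matrix ι ι (ℕ →₀ A)) {c : ℝ}
    (hP : ∀ N, cmNorm (finiteSection α N P) ≤ c) : cmNorm (P.map (crossedPoly β j)) ≤ c := by
  rw [← cmNorm_map_of_injective (crossedSubtype β) Subtype.val_injective]
  refine cmNorm_le_of_lpEval _ ((cmNorm_nonneg _).trans (hP 0)) fun τ => ?_
  have := cmNorm_polyEval_le (α := α) (π := τ.σ.comp j) (K := (τ.U : BH τ.H))
    (ContinuousLinearMap.opNorm_le_bound _ zero_le_one fun x => by rw [Unitary.norm_map, one_mul])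
    (fun a => by
      change τ.σ (j a) * _ = _ * τ.σ (j (α a))
      rw [τ.covariance, hj]) P hP
  refine le_of_eq_of_le (congrArg cmNorm ?_) this
  exact Matrix.ext fun k l => crossedPoly_apply (P k l) τ

/-- The unitary regular representation must start from a representation `σ` of `B`; injectivity of
`j` ensures that the restrictions `σ ∘ j` still detect norms over `A`. -/
theorem cmNorm_finiteSection_le_crossedPoly (hj : ∀ a, β (j a) = j (α a))
    (hinj : Function.Injective j) (N : ℕ) (P : Matrix ι ι (ℕ →₀ A)) :
    cmNorm (finiteSection α N P) ≤ cmNorm (P.map (crossedPoly β j)) := by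
  refine cmNorm_le_of_gns j hinj _ (cmNorm_nonneg _) fun H _ _ _ σ => ?_
  let τ := regularCovRep β σ
  have h1 := cmNorm_map_finiteSection_le (α := α) (σ.comp j)
    ((τ.σ.comp j : A →⋆ₙₐ[ℂ] BH τ.H) : A →ₗ[ℂ] BH τ.H) (τ.U : BH τ.H)
    (fun i => coordinateInclusion H i)
    (fun i j x y => (inner_coordinateInclusion _ _ x y).trans (by simp only [Nat.cast_inj]))
    (fun i x => bilateralShift_coordinateInclusion (i : ℤ) x)
    (fun a i x => by
      refine (diagonalRep_coordinateInclusion _ (j a) i x).trans ?_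
      change coordinateInclusion H i (σ ((β ^ (i : ℤ)) (j a)) x) = _
      rw [zpow_map_eq hj]
      rfl) N P
  refine h1.trans (le_of_eq_of_le (congrArg cmNorm ?_)
    (cmNorm_map_le ((lpEval τ).comp (crossedSubtype β)) (P.map (crossedPoly β j))))
  exact Matrix.ext fun k l => (crossedPoly_apply (P k l) τ).symm

/-- The universal norms of a matrix of polynomials in the semicrossed product and in the crossed
product agree. -/
theorem cmNorm_crossedPoly_eq (hj : ∀ a, β (j a) = j (α a)) (hinj : Function.Injective j)
    (P : Matrix ι ι (ℕ →₀ A)) :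
    cmNorm (P.map (crossedPoly β j)) = cmNorm (P.map (semicrossedPoly α)) :=
  le_antisymm
    (cmNorm_crossedPoly_le hj P fun N => cmNorm_finiteSection_le_semicrossedPoly α N P)
    (cmNorm_semicrossedPoly_le α P fun N => cmNorm_finiteSection_le_crossedPoly hj hinj N P)

end CrossedPoly

/-! ### Extension to closures, generation, and the C⋆-cover. -/

/-- A pair of linear maps into C⋆-algebras with the same matrix norms and compatible products
induces a completely isometric homomorphism. -/
theorem exists_completelyIsometric_extension {X E F : Type*} [AddCommGroup X] [Module ℂ X]
    [NonUnitalCStarAlgebra E] [NonUnitalCStarAlgebra F] (S : NonUnitalSubalgebra ℂ E)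
    (f : X →ₗ[ℂ] E) (g : X →ₗ[ℂ] F) (hf : ∀ p, f p ∈ S) (hS : (S : Set E) ⊆ closure (Set.range f))
    (hmul : ∀ p q, ∃ r, f p * f q = f r ∧ g p * g q = g r)
    (hnorm : ∀ (n : ℕ) (P : Matrix (Fin n) (Fin n) X), cmNorm (P.map g) = cmNorm (P.map f)) :
    ∃ Φ : S →ₙₐ[ℂ] F, (∀ p, Φ ⟨f p, hf p⟩ = g p) ∧ IsCompletelyIsometric Φ := by
  let e : X →ₗ[ℂ] S :=
    { toFun := fun p => ⟨f p, hf p⟩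
      map_add' := fun p q => Subtype.ext (f.map_add p q)
      map_smul' := fun c p => Subtype.ext (f.map_smul c p) }
  have he : DenseRange e := by
    intro x
    rw [closure_subtype, ← Set.range_comp]
    exact hS x.2
  have hn : ∀ p, ‖g p‖ = ‖e p‖ := fun p =>
    calc ‖g p‖ = cmNorm (fun _ _ : Fin 1 => g p) := (matrixNorm_one_by_one _).symm
      _ = cmNorm (fun _ _ : Fin 1 => f p) := hnorm 1 fun _ _ => p
      _ = ‖f p‖ := matrixNorm_one_by_one _
  have : IsBoundedSMul ℂ S := IsBoundedSMul.of_norm_smul_le fun c x => norm_smul_le c (x : E)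
  have hbound : ∃ C, ∀ p, ‖g p‖ ≤ C * ‖e p‖ := ⟨1, fun p => by rw [one_mul, hn]⟩
  -- Equality of norms makes `f p ↦ g p` well defined even when `f` is not injective.
  let φ : S →L[ℂ] F := g.extendOfNorm e
  have hφ : ∀ p, φ (e p) = g p := fun p => LinearMap.extendOfNorm_eq he hbound p
  let Φ : S →ₙₐ[ℂ] F :=
    { toFun := φ
      map_smul' := fun c x => φ.map_smul c x
      map_zero' := φ.map_zero
      map_add' := φ.map_add
      map_mul' := fun x y => by
        induction x, y using he.induction_on₂ with
        | hp =>
          exact isClosed_eq (by fun_prop) (by fun_prop)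
        | h p q =>
          obtain ⟨r, h1, h2⟩ := hmul p q
          have : e p * e q = e r := Subtype.ext h1
          rw [this, hφ, hφ, hφ, h2] }
  refine ⟨Φ, hφ, fun n M => ?_⟩
  -- Matrices of polynomials are dense entrywise, so the isometry identity extends by continuity.
  let D : Matrix (Fin n) (Fin n) X → Matrix (Fin n) (Fin n) S := Pi.map fun _ => Pi.map fun _ => e
  have hD : DenseRange D := DenseRange.piMap fun _ => DenseRange.piMap fun _ => he
  have hc1 : Continuous fun M : Matrix (Fin n) (Fin n) S => cmNorm (M.map Φ) :=
    continuous_cmNorm.comp (continuous_id.matrix_map φ.continuous)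
  have hc2 : Continuous fun M : Matrix (Fin n) (Fin n) S => cmNorm (M.map fun s : S => (s : E)) :=
    continuous_cmNorm.comp (continuous_id.matrix_map continuous_subtype_val)
  change cmNorm (M.map Φ) = cmNorm (M.map fun s : S => (s : E))
  induction M using hD.induction_on with
  | hp => exact isClosed_eq hc1 hc2
  | ih P =>
    refine Eq.trans (congrArg cmNorm ?_) (hnorm n P)
    exact Matrix.ext fun k l => hφ (P k l)

/-- A closed ⋆-subalgebra that contains a generating set of a C⋆-algebra is everything. -/
theorem eq_top_of_adjoin_dense {C E : Type*} [NonUnitalCStarAlgebra C] [NonUnitalCStarAlgebra E]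
    (f : C →⋆ₙₐ[ℂ] E) (hf : Function.Injective f) (s : Set E)
    (hs : ∀ x, f x ∈ closure (NonUnitalStarAlgebra.adjoin ℂ s : Set E))
    (D : NonUnitalStarSubalgebra ℂ C) (hD : IsClosed (D : Set C)) (hsD : s ⊆ f '' D) : D = ⊤ := by
  have hiso : Isometry f :=
    AddMonoidHomClass.isometry_of_norm f (NonUnitalStarAlgHom.norm_map f hf)
  have hcl : IsClosed (f '' D) := hiso.isClosedEmbedding.isClosedMap _ hD
  have hle : NonUnitalStarAlgebra.adjoin ℂ s ≤ D.map f :=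
    NonUnitalStarAlgebra.adjoin_le hsD
  refine eq_top_iff.2 fun x _ => ?_
  obtain ⟨y, hy, hyx⟩ := hcl.closure_subset_iff.2 (show _ ⊆ f '' D from hle) (hs x)
  exact hf hyx ▸ hy

theorem isCStarCover_of_forall_eq_top {C : Type*} [NonUnitalCStarAlgebra C]
    (S : NonUnitalSubalgebra ℂ C) (h : ∀ D : NonUnitalStarSubalgebra ℂ C, IsClosed (D : Set C) →
      (S : Set C) ⊆ D → D = ⊤) : IsCStarCover S :=
  h _ (NonUnitalStarSubalgebra.isClosed_topologicalClosure _) fun _ hx =>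
    NonUnitalStarSubalgebra.le_topologicalClosure _ (NonUnitalStarAlgebra.subset_adjoin ℂ _ hx)

section Polynomials

variable {A : Type*} [NonUnitalCStarAlgebra A] (α : A →⋆ₙₐ[ℂ] A)

/-- The product of polynomials `(∑ₘ Vᵐ pₘ) (∑ₙ Vⁿ qₙ) = ∑ Vᵐ⁺ⁿ αⁿ(pₘ) qₙ`. -/
def polyMul (p q : ℕ →₀ A) : ℕ →₀ A :=
  p.sum fun m a => q.sum fun n b => Finsupp.single (m + n) (α^[n] a * b)

/-- Used for both products, so that the same polynomial represents the product on each side. -/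
theorem map_polyMul {E : Type*} [NonUnitalNonAssocRing E] [Module ℂ E] (f : (ℕ →₀ A) →ₗ[ℂ] E)
    (hf : ∀ m n a b, f (Finsupp.single m a) * f (Finsupp.single n b) =
      f (Finsupp.single (m + n) (α^[n] a * b))) (p q : ℕ →₀ A) :
    f p * f q = f (polyMul α p q) := by
  have h : ∀ p, f p = p.sum fun m a => f (Finsupp.single m a) := by
    intro p
    conv_lhs => rw [← p.sum_single]
    exact map_finsuppSum f p _
  rw [polyMul, map_finsuppSum, h p, h q, Finsupp.sum_mul]
  refine Finsupp.sum_congr fun m _ => ?_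
  rw [map_finsuppSum, Finsupp.mul_sum]
  exact Finsupp.sum_congr fun n _ => hf _ _ _ _

theorem semicrossedPoly_mem_adjoin (p : ℕ →₀ A) : semicrossedPoly α p ∈
    NonUnitalAlgebra.adjoin ℂ {x | ∃ (n : ℕ) (a : A), x = semicrossedMonomial α n a} := by
  induction p using Finsupp.induction_linear with
  | zero => rw [LinearMap.map_zero]; exact zero_mem _
  | add p q hp hq => rw [LinearMap.map_add]; exact add_mem hp hq
  | single m a =>
    rw [semicrossedPoly_single]
    exact NonUnitalAlgebra.subset_adjoin ℂ ⟨m, a, rfl⟩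

theorem semicrossedPoly_mul (p q : ℕ →₀ A) :
    semicrossedPoly α p * semicrossedPoly α q = semicrossedPoly α (polyMul α p q) :=
  map_polyMul α (semicrossedPoly α) (fun m n a b => by
    rw [semicrossedPoly_single, semicrossedPoly_single, semicrossedPoly_single,
      semicrossedMonomial_mul]) p q

theorem exists_semicrossedPoly_eq {x : SemicrossedAmbient α}
    (hx : x ∈ NonUnitalAlgebra.adjoin ℂ {x | ∃ (n : ℕ) (a : A), x = semicrossedMonomial α n a}) :
    ∃ p, semicrossedPoly α p = x := by
  induction hx using NonUnitalAlgebra.adjoin_induction with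
  | mem x hx =>
    obtain ⟨n, a, rfl⟩ := hx
    exact ⟨_, semicrossedPoly_single α n a⟩
  | add x y _ _ hx hy =>
    obtain ⟨p, rfl⟩ := hx
    obtain ⟨q, rfl⟩ := hy
    exact ⟨p + q, LinearMap.map_add _ p q⟩
  | zero => exact ⟨0, LinearMap.map_zero _⟩
  | mul x y _ _ hx hy =>
    obtain ⟨p, rfl⟩ := hx
    obtain ⟨q, rfl⟩ := hy
    exact ⟨polyMul α p q, (semicrossedPoly_mul α p q).symm⟩
  | smul c x _ hx =>
    obtain ⟨p, rfl⟩ := hx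
    exact ⟨c • p, LinearMap.map_smul _ c p⟩

end Polynomials

section Cover

variable {A : Type u} {B : Type v} [NonUnitalCStarAlgebra A] [NonUnitalCStarAlgebra B]
  {α : A →⋆ₙₐ[ℂ] A} {β : B ≃⋆ₐ[ℂ] B} {j : A →⋆ₙₐ[ℂ] B}

theorem crossedPoly_mul (hj : ∀ a, β (j a) = j (α a)) (p q : ℕ →₀ A) :
    crossedPoly β j p * crossedPoly β j q = crossedPoly β j (polyMul α p q) :=
  map_polyMul α (crossedPoly β j) (fun m n a b => by
    rw [crossedPoly_single, crossedPoly_single, crossedPoly_single,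
      CrossedProduct.monomial_mul, zpow_map_eq hj, map_mul, Nat.cast_add]) p q

/-- Adjoints supply the negative powers: with `l` large, both factors on the left are analytic even
when `n < 0`. -/
theorem CrossedProduct.monomial_mul_star_monomial (n : ℤ) (l : ℕ) (b c : B) :
    CrossedProduct.monomial β (n + l) b * star (CrossedProduct.monomial β (l : ℤ) c) =
      crossedMonomialₗ β n ((β ^ (-(l : ℤ))) (b * star c)) := by
  rw [CrossedProduct.star_monomial, CrossedProduct.monomial_mul, ← map_mul, ← sub_eq_add_neg,
    add_sub_cancel_right, crossedMonomialₗ_apply]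

/-- A closed ⋆-subalgebra of the crossed product that contains the analytic monomials
`Uᵐ j(a)`, `m ≥ 0`, contains all monomials. -/
theorem monomial_mem_of_isClosed (hext : IsMinimalAutomorphicExtension α β j)
    (D : NonUnitalStarSubalgebra ℂ (CrossedProduct β)) (hD : IsClosed (D : Set (CrossedProduct β)))
    (h : ∀ (m : ℕ) (a : A), CrossedProduct.monomial β (m : ℤ) (j a) ∈ D) (n : ℤ) (b : B) :
    CrossedProduct.monomial β n b ∈ D := by
  have hstep : ∀ (l : ℕ), 0 ≤ n + l → ∀ a : A,
      crossedMonomialₗ β n ((β ^ (-(l : ℤ))) (j a)) ∈ D := by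
    intro l hl a
    have hprod : ∀ c : A, crossedMonomialₗ β n ((β ^ (-(l : ℤ))) (j (a * c))) ∈ D := by
      intro c
      obtain ⟨m, hm⟩ := Int.eq_ofNat_of_zero_le hl
      have := CrossedProduct.monomial_mul_star_monomial (β := β) n l (j a) (j (star c))
      rw [map_star, star_star, ← map_mul, hm] at this
      rw [← this, ← map_star]
      exact mul_mem (h m a) (star_mem (h l _))
    -- Products `a * c` suffice: letting `c` run through an approximate unit recovers `a`.
    let _ := CStarAlgebra.spectralOrder A
    have := CStarAlgebra.spectralOrderedRing A
    have hl' := CStarAlgebra.increasingApproximateUnit A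
    have := hl'.neBot
    have hcont : Continuous fun a : A => crossedMonomialₗ β n ((β ^ (-(l : ℤ))) (j a)) := by
      refine (continuous_crossedMonomialₗ β n).comp (Continuous.comp ?_ ?_)
      · exact (StarAlgEquiv.isometry (β ^ (-(l : ℤ)))).continuous
      · exact AddMonoidHomClass.continuous_of_bound j 1 fun a => by
          simpa using NonUnitalStarAlgHom.norm_apply_le j a
    exact hD.mem_of_tendsto ((hcont.tendsto a).comp (hl'.tendsto_mul_left a))
      (Filter.Eventually.of_forall hprod)
  have hcl : IsClosed {b : B | crossedMonomialₗ β n b ∈ D} :=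
    hD.preimage (continuous_crossedMonomialₗ β n)
  have hsub : (⋃ k : ℕ, (β.symm)^[k] '' Set.range j) ⊆ {b : B | crossedMonomialₗ β n b ∈ D} := by
    refine Set.iUnion_subset fun k => ?_
    rintro _ ⟨_, ⟨a, rfl⟩, rfl⟩
    -- Taking `l = k + |n|` ensures `n + l ≥ 0`; replacing `a` by `α^|n| a` cancels the extra
    -- `β^{-|n|}` and leaves `β^{-k}(j a)`.
    have h1 := hstep (k + n.natAbs) (by omega) (α^[n.natAbs] a)
    rw [← zpow_map_eq hext.intertwines, ← StarAlgEquiv.mul_apply, ← zpow_add] at h1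
    have h2 : (β.symm)^[k] (j a) =
        (β ^ (-((k + n.natAbs : ℕ) : ℤ) + (n.natAbs : ℤ))) (j a) := by
      rw [show -((k + n.natAbs : ℕ) : ℤ) + (n.natAbs : ℤ) = -(k : ℤ) by push_cast; ring,
        ← inv_zpow', zpow_natCast, StarAlgEquiv.coe_pow]
      rfl
    rw [Set.mem_ofPred_eq, h2]
    exact h1
  have : b ∈ closure (⋃ k : ℕ, (β.symm)^[k] '' Set.range j) := by
    rw [hext.dense]
    trivial
  exact hcl.closure_subset_iff.2 hsub this

theorem eq_top_of_forall_monomial_mem (D : NonUnitalStarSubalgebra ℂ (CrossedProduct β))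
    (hD : IsClosed (D : Set (CrossedProduct β)))
    (h : ∀ (n : ℤ) (b : B), CrossedProduct.monomial β n b ∈ D) : D = ⊤ :=
  eq_top_of_adjoin_dense (crossedSubtype β) Subtype.val_injective
    {x | ∃ (n : ℤ) (b : B), x = crossedMonomial β n b} (fun x => x.2) D hD (by
      rintro _ ⟨n, b, rfl⟩
      exact ⟨_, h n b, rfl⟩)

end Cover

end Semicrossed

end

theorem proposition2p2 {A : Type u} {B : Type v} [NonUnitalCStarAlgebra A]
    [NonUnitalCStarAlgebra B] (α : A →⋆ₙₐ[ℂ] A) (hα : Function.Injective α)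
    (β : B ≃⋆ₐ[ℂ] B) (j : A →⋆ₙₐ[ℂ] B)
    (hext : Semicrossed.IsMinimalAutomorphicExtension α β j) :
    ∃ Φ : Semicrossed.SemicrossedProduct α →ₙₐ[ℂ] Semicrossed.CrossedProduct β,
      (∀ (n : ℕ) (a : A), Φ (Semicrossed.SemicrossedProduct.monomial α n a) =
        Semicrossed.CrossedProduct.monomial β (n : ℤ) (j a)) ∧
      Semicrossed.IsCompletelyIsometric Φ ∧
      Semicrossed.IsCStarCover (NonUnitalAlgHom.range Φ) := by
  obtain ⟨Φ, hΦ, hiso⟩ := Semicrossed.exists_completelyIsometric_extension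
    (Semicrossed.SemicrossedProduct α) (Semicrossed.semicrossedPoly α)
    (Semicrossed.crossedPoly β j)
    (fun p => NonUnitalSubalgebra.le_topologicalClosure _
      (Semicrossed.semicrossedPoly_mem_adjoin α p))
    (closure_mono fun _ hx => Semicrossed.exists_semicrossedPoly_eq α hx)
    (fun p q => ⟨Semicrossed.polyMul α p q, Semicrossed.semicrossedPoly_mul α p q,
      Semicrossed.crossedPoly_mul hext.intertwines p q⟩)
    (fun _ P => Semicrossed.cmNorm_crossedPoly_eq hext.intertwines hext.injective P)
  have hmono : ∀ (n : ℕ) (a : A), Φ (Semicrossed.SemicrossedProduct.monomial α n a) =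
      Semicrossed.CrossedProduct.monomial β (n : ℤ) (j a) := by
    intro n a
    rw [← Semicrossed.crossedPoly_single, ← hΦ]
    exact congrArg Φ (Subtype.ext (Semicrossed.semicrossedPoly_single α n a).symm)
  refine ⟨Φ, hmono, hiso, ?_⟩
  exact Semicrossed.isCStarCover_of_forall_eq_top _ fun D hD hsub =>
    Semicrossed.eq_top_of_forall_monomial_mem D hD
      (Semicrossed.monomial_mem_of_isClosed hext D hD fun m a => hsub ⟨_, hmono m a⟩)
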